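/- **Setting.** All rings are associative with $1$, and "ideal" means two-sided ideal. Let $R$ be a nonzero ring with an ideal $\mathfrak{i}$ such that the $\mathfrak{i}$-adic filtration of $R$ is separated and complete and the associated graded ring $\mathrm{gr}\,R=\bigoplus_{n\ge 0}\mathfrak{i}^n/\mathfrak{i}^{n+1}$ is left and right noetherian. Let $\tau$ be a ring automorphism of $R$ with $\tau(\mathfrak{i})=\mathfrak{i}$, and let $\delta:R\to R$ be an additive map with $\delta(ab)=\tau(a)\delta(b)+\delta(a)b$ for all $a,b\in R$, $\delta(R)\subseteq\mathfrak{i}$ and $\delta(\mathfrak{i})\subseteq\mathfrak{i}^2$. Let $T=R[[y;\tau,\delta]]$ be the skew power series ring: its elements are the formal series $\sum_{n\ge0}r_ny^n$ with $r_n\in R$, and its multiplication is $$\Big(\sum_m a_my^m\Big)\Big(\sum_j b_jy^j\Big)=\sum_{n\ge0}\Big(\sum_{j=0}^{n}\sum_{m=0}^{\infty}a_m\,\theta_{m,n-j}(b_j)\Big)y^n ,$$ where the inner sums converge in the $\mathfrak{i}$-adic topology of $R$ and the maps $\theta_{m,k}:R\to R$ are determined by $y^mr=\sum_{k=0}^m\theta_{m,k}(r)y^k$,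 that is, by the rule $yr=\tau(r)y+\delta(r)$. Let $S=R[y;\tau,\delta]\subseteq T$ be the subring of series with only finitely many nonzero coefficients. Let $\mathfrak{j}$ be the ideal of $T$ generated by $\mathfrak{i}$ and $y$, and give $T$ the $\mathfrak{j}$-adic topology. For subsets $U,V\subseteq T$ let $UV$ denote the set of finite sums of products $uv$ with $u\in U$, $v\in V$. **Lemma.** Let $I$ be a $\tau$-$\delta$-ideal of $R$, i.e. an ideal with $\tau(I)=I$ and $\delta(I)\subseteq I$. Put $I[[y;\tau,\delta]]:=\{\sum a_ny^n : a_n\in I \text{ for all } n\}\subseteq T$. Then: 1. For all $b_0,b_1,\ldots\in I$ the series $\sum_n y^nb_n$ converges in $T$, and $I[[y;\tau,\delta]]=\{\sum y^nb_n : b_n\in I \text{ for all } n\}$. 2. $IS=SI$, and $I[[y;\tau,\delta]]$ is a two-sided ideal of $T$ and is the closure of $IS=SI$ in $T$. 3. $IT=I[[y;\tau,\delta]]=TI$. 4. The ring $R/I$, with the ideal $(\mathfrak{i}+I)/I$ and the maps induced by $\tau$ and $\delta$, again satisfies the assumptions above (except that it is the zero ring when $I=R$), and reduction of coefficients modulo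 $I$ induces a ring isomorphism $T/IT\cong(R/I)[[y;\tau,\delta]]$. -/

import Mathlib

open Filter

/-! ### Adic topologies on (noncommutative) rings -/

section Adic

variable {A : Type*} [Ring A]

theorem adicBasis (J : Ideal A) [J.IsTwoSided] :
    RingSubgroupsBasis (fun n : ℕ => (J ^ n).toAddSubgroup) where
  inter m n := ⟨max m n, le_inf
    (fun _ hx => Ideal.pow_le_pow_right (le_max_left m n) hx)
    (fun _ hx => Ideal.pow_le_pow_right (le_max_right m n) hx)⟩
  mul n := ⟨n, by
    rintro _ ⟨x, _, y, hy, rfl⟩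
    exact (J ^ n).mul_mem_left x hy⟩
  leftMul x n := ⟨n, fun _ hy => (J ^ n).mul_mem_left x hy⟩
  rightMul x n := ⟨n, fun _ hy => (J ^ n).mul_mem_right x hy⟩

/-- The `J`-adic topology on a ring `A`, for a two-sided ideal `J`: the powers `J ^ n` form a
fundamental system of neighbourhoods of `0`. -/
@[reducible] def adicTopology (J : Ideal A) [J.IsTwoSided] : TopologicalSpace A :=
  (adicBasis J).topology

/-- The sequence `u` converges to `L` in the `J`-adic topology. -/
def AdicTendsto (J : Ideal A) [J.IsTwoSided] (u : ℕ → A) (L : A) : Prop :=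
  Tendsto u atTop (@nhds A (adicTopology J) L)

theorem adicTendsto_iff (J : Ideal A) [J.IsTwoSided] (u : ℕ → A) (L : A) :
    AdicTendsto J u L ↔ ∀ n : ℕ, ∃ N : ℕ, ∀ m, N ≤ m → u m - L ∈ J ^ n := by
  unfold AdicTendsto
  rw [((adicBasis J).hasBasis_nhds L).tendsto_right_iff]
  simp [eventually_atTop]

/-- The `J`-adic filtration of `A` is separated. -/
def AdicSeparated (J : Ideal A) : Prop :=
  ∀ x : A, (∀ n : ℕ, x ∈ J ^ n) → x = 0

/-- The `J`-adic filtration of `A` is complete: every Cauchy sequence converges. -/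
def AdicComplete (J : Ideal A) [J.IsTwoSided] : Prop :=
  ∀ u : ℕ → A, (∀ n : ℕ, ∃ N : ℕ, ∀ p q, N ≤ p → N ≤ q → u p - u q ∈ J ^ n) →
    ∃ L : A, AdicTendsto J u L

open Classical in
/-- The sum `∑_{k = 0}^∞ u k`, taken as a limit of partial sums in the `J`-adic topology
(and `0` if there is no such limit). -/
noncomputable def adicSum (J : Ideal A) [J.IsTwoSided] (u : ℕ → A) : A :=
  if h : ∃ L : A, AdicTendsto J (fun m => ∑ k ∈ Finset.range m, u k) L then h.choose else 0

open Polynomial in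
/-- The Rees ring `A ⊕ J ⊕ J² ⊕ ⋯` of the `J`-adic filtration, as the subring of the polynomial
ring `A[X]` (with `X` central) of the polynomials whose `n`-th coefficient lies in `J ^ n`. -/
def reesRing (J : Ideal A) [J.IsTwoSided] : Subring A[X] where
  carrier := {f | ∀ n, f.coeff n ∈ J ^ n}
  zero_mem' n := by simp
  one_mem' n := by
    rcases n with _ | n
    · simp [Submodule.pow_zero]
    · simp [Polynomial.coeff_one]
  add_mem' hf hg n := by
    rw [Polynomial.coeff_add]
    exact (J ^ n).add_mem (hf n) (hg n)
  neg_mem' hf n := by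
    rw [Polynomial.coeff_neg]
    exact (J ^ n).neg_mem (hf n)
  mul_mem' {f g} hf hg n := by
    rw [Polynomial.coeff_mul]
    refine Ideal.sum_mem _ fun p hp => ?_
    rw [← Finset.HasAntidiagonal.mem_antidiagonal.mp hp, Ideal.IsTwoSided.pow_add]
    exact Ideal.mul_mem_mul (hf _) (hg _)

/-- The ideal `J ⊕ J² ⊕ J³ ⊕ ⋯` of the Rees ring `A ⊕ J ⊕ J² ⊕ ⋯`. -/
def reesShift (J : Ideal A) [J.IsTwoSided] : Ideal (reesRing J) where
  carrier := {f | ∀ n, f.1.coeff n ∈ J ^ (n + 1)}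
  zero_mem' n := by simp
  add_mem' {f g} hf hg n := by
    have : (f + g).1.coeff n = f.1.coeff n + g.1.coeff n := by simp
    rw [this]
    exact (J ^ (n + 1)).add_mem (hf n) (hg n)
  smul_mem' c f hf n := by
    have : (c • f).1 = c.1 * f.1 := rfl
    rw [this, Polynomial.coeff_mul]
    refine Ideal.sum_mem _ fun p hp => ?_
    rw [← Finset.HasAntidiagonal.mem_antidiagonal.mp hp, add_assoc, Ideal.IsTwoSided.pow_add]
    exact Ideal.mul_mem_mul (c.2 _) (hf _)

instance (J : Ideal A) [J.IsTwoSided] : (reesShift J).IsTwoSided where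
  mul_mem_of_left {f} c hf n := by
    have : (f * c).1 = f.1 * c.1 := rfl
    rw [this, Polynomial.coeff_mul]
    refine Ideal.sum_mem _ fun p hp => ?_
    rw [← Finset.HasAntidiagonal.mem_antidiagonal.mp hp, add_right_comm, Ideal.IsTwoSided.pow_add]
    exact Ideal.mul_mem_mul (hf _) (c.2 _)

/-- The associated graded ring `gr A = A/J ⊕ J/J² ⊕ J²/J³ ⊕ ⋯` of the `J`-adic filtration, as the
quotient of `A ⊕ J ⊕ J² ⊕ ⋯` by `J ⊕ J² ⊕ J³ ⊕ ⋯`. -/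
abbrev AssocGraded (J : Ideal A) [J.IsTwoSided] : Type _ := reesRing J ⧸ reesShift J

end Adic

/-! ### The standing assumptions on the coefficient ring -/

/-- The standing assumptions on a ring `R` with an ideal `i`, an automorphism `τ` and an additive
map `δ`: the `i`-adic filtration is separated and complete, its associated graded ring is left and
right noetherian, `δ` is a left `τ`-derivation, `τ(i) = i`, `δ(R) ⊆ i` and `δ(i) ⊆ i²`. -/
structure SkewSetup {R : Type*} [Ring R] (i : Ideal R) [i.IsTwoSided]
    (τ : R ≃+* R) (δ : R →+ R) : Prop where
  separated : AdicSeparated i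
  complete : AdicComplete i
  noeth_left : IsNoetherianRing (AssocGraded i)
  noeth_right : IsNoetherianRing (AssocGraded i)ᵐᵒᵖ
  leibniz : ∀ a b : R, δ (a * b) = τ a * δ b + δ a * b
  map_tau : τ '' (i : Set R) = i
  delta_mem : ∀ a : R, δ a ∈ i
  delta_mem_sq : ∀ a ∈ i, δ a ∈ i ^ 2

/-- The coefficients `θ_{m,k}(r)` in `y ^ m * r = ∑_k θ_{m,k}(r) y ^ k`, determined by
`y r = τ(r) y + δ(r)`. -/
def skewTheta {R : Type*} [Ring R] (τ : R ≃+* R) (δ : R →+ R) : ℕ → ℕ → (R →+ R)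
  | 0, 0 => AddMonoidHom.id R
  | 0, _ + 1 => 0
  | m + 1, 0 => δ.comp (skewTheta τ δ m 0)
  | m + 1, k + 1 =>
      (τ : R →+ R).comp (skewTheta τ δ m k) + δ.comp (skewTheta τ δ m (k + 1))

/-- The underlying set of `T = R[[y; τ, δ]]`: formal series `∑ r_n y ^ n` with coefficients in `R`
written on the left. -/
@[ext] structure SkewPowerSeries {R : Type*} [Ring R] {i : Ideal R} [i.IsTwoSided]
    {τ : R ≃+* R} {δ : R →+ R} (h : SkewSetup i τ δ) where
  /-- The coefficient of `y ^ n`. -/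
  coeff : ℕ → R

namespace SkewSetup

variable {R : Type*} [Ring R] {i : Ideal R} [i.IsTwoSided] {τ : R ≃+* R} {δ : R →+ R}

theorem eq_of_mod (h : SkewSetup i τ δ) {x y : R} (hxy : ∀ N : ℕ, x - y ∈ i ^ N) : x = y :=
  sub_eq_zero.mp (h.separated _ hxy)

theorem delta_one (h : SkewSetup i τ δ) : δ 1 = 0 := by
  have := h.leibniz 1 1
  simpa using this

theorem tau_pow (h : SkewSetup i τ δ) (a : ℕ) : ∀ r ∈ i ^ a, τ r ∈ i ^ a := by
  induction a with
  | zero => intro r _; simp [Submodule.pow_zero]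
  | succ a ih =>
    intro r hr
    rw [Ideal.IsTwoSided.pow_succ] at hr ⊢
    refine Submodule.smul_induction_on hr (fun x hx y hy => ?_) (fun x y hx hy => ?_)
    · rw [smul_eq_mul, map_mul]
      refine Ideal.mul_mem_mul ?_ (ih y hy)
      have : τ x ∈ τ '' (i : Set R) := ⟨x, hx, rfl⟩
      rwa [h.map_tau] at this
    · rw [map_add]; exact Ideal.add_mem _ hx hy

theorem delta_pow (h : SkewSetup i τ δ) (a : ℕ) : ∀ r ∈ i ^ a, δ r ∈ i ^ (a + 1) := by
  induction a with
  | zero => intro r _; simpa [Submodule.pow_one] using h.delta_mem r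
  | succ a ih =>
    intro r hr
    rw [Ideal.IsTwoSided.pow_succ] at hr
    refine Submodule.smul_induction_on hr (fun x hx y hy => ?_) (fun x y hx hy => ?_)
    · rw [smul_eq_mul, h.leibniz]
      refine Ideal.add_mem _ ?_ ?_
      · rw [Ideal.IsTwoSided.pow_succ]
        refine Ideal.mul_mem_mul ?_ (ih y hy)
        have : τ x ∈ τ '' (i : Set R) := ⟨x, hx, rfl⟩
        rwa [h.map_tau] at this
      · rw [show a + 1 + 1 = 2 + a by ring, Ideal.IsTwoSided.pow_add]
        exact Ideal.mul_mem_mul (h.delta_mem_sq x hx) hy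
    · rw [map_add]; exact Ideal.add_mem _ hx hy

theorem theta_eq_zero (τ : R ≃+* R) (δ : R →+ R) (m : ℕ) :
    ∀ k, m < k → skewTheta τ δ m k = 0 := by
  induction m with
  | zero =>
    intro k hk
    obtain ⟨k, rfl⟩ := Nat.exists_eq_succ_of_ne_zero hk.ne'
    rfl
  | succ m ih =>
    intro k hk
    obtain ⟨k, rfl⟩ := Nat.exists_eq_succ_of_ne_zero (by omega : k ≠ 0)
    ext r
    simp [skewTheta, ih k (by omega), ih (k + 1) (by omega)]

theorem theta_mem (h : SkewSetup i τ δ) (m : ℕ) :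
    ∀ k r, skewTheta τ δ m k r ∈ i ^ (m - k) := by
  induction m with
  | zero => intro k r; simp [Submodule.pow_zero]
  | succ m ih =>
    intro k r
    rcases k with _ | k
    · exact h.delta_pow _ _ (ih 0 r)
    · have h1 := h.tau_pow _ _ (ih k r)
      have h2 := h.delta_pow _ _ (ih (k + 1) r)
      have e : m + 1 - (k + 1) = m - k := by omega
      rw [e]
      exact Ideal.add_mem _ h1 (Ideal.pow_le_pow_right (by omega) h2)

/-- Left multiplication by `y` on sequences of coefficients. -/
def leftY (τ : R ≃+* R) (δ : R →+ R) (g : ℕ → R) : ℕ → R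
  | 0 => δ (g 0)
  | n + 1 => τ (g n) + δ (g (n + 1))

theorem leftY_iter (τ : R ≃+* R) (δ : R →+ R) (g : ℕ → R) (m : ℕ) : ∀ n,
    (leftY τ δ)^[m] g n = ∑ j ∈ Finset.range (n + 1), skewTheta τ δ m (n - j) (g j) := by
  induction m with
  | zero =>
    intro n
    rw [Finset.sum_range_succ, Finset.sum_eq_zero]
    · simp [skewTheta]
    · intro j hj
      rw [theta_eq_zero τ δ 0 (n - j) (by have := Finset.mem_range.mp hj; omega)]
      rfl
  | succ m ih =>
    intro n
    rw [Function.iterate_succ_apply']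
    rcases n with _ | n
    · simp only [leftY, ih]
      simp [skewTheta]
    · simp only [leftY, ih]
      rw [Finset.sum_range_succ _ (n + 1), Finset.sum_range_succ _ (n + 1), map_sum, map_add,
        map_sum, ← add_assoc, ← Finset.sum_add_distrib]
      congr 1
      · refine Finset.sum_congr rfl fun j hj => ?_
        have e : n + 1 - j = (n - j) + 1 := by have := Finset.mem_range.mp hj; omega
        rw [e]
        rfl
      · simp [skewTheta]

theorem leftY_iter_mem (h : SkewSetup i τ δ) (g : ℕ → R) (m n : ℕ) :
    (leftY τ δ)^[m] g n ∈ i ^ (m - n) := by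
  rw [leftY_iter]
  exact Ideal.sum_mem _ fun j _ =>
    Ideal.pow_le_pow_right (by omega) (h.theta_mem m (n - j) (g j))

/-- A series whose terms tend to zero at a controlled rate converges at that rate. -/
theorem adicSum_approx (h : SkewSetup i τ δ) (u : ℕ → R) (c : ℕ)
    (hu : ∀ m, u m ∈ i ^ (m - c)) (N K : ℕ) (hK : N + c ≤ K) :
    ∑ k ∈ Finset.range K, u k - adicSum i u ∈ i ^ N := by
  have key : ∀ N p q, N + c ≤ p → p ≤ q →
      ∑ k ∈ Finset.range q, u k - ∑ k ∈ Finset.range p, u k ∈ i ^ N := by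
    intro N p q hp hpq
    rw [← Finset.sum_Ico_eq_sub _ hpq]
    refine Ideal.sum_mem _ fun k hk => ?_
    have := (Finset.mem_Ico.mp hk).1
    exact Ideal.pow_le_pow_right (by omega) (hu k)
  have hex : ∃ L : R, AdicTendsto i (fun m => ∑ k ∈ Finset.range m, u k) L := by
    refine h.complete _ fun n => ⟨n + c, fun p q hp hq => ?_⟩
    rcases le_total p q with hpq | hpq
    · rw [← neg_sub]
      exact Ideal.neg_mem_iff _ |>.mpr (key n p q hp hpq)
    · exact key n q p hq hpq
  have hL : AdicTendsto i (fun m => ∑ k ∈ Finset.range m, u k) (adicSum i u) := by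
    rw [adicSum, dif_pos hex]
    exact hex.choose_spec
  obtain ⟨M, hM⟩ := (adicTendsto_iff i _ _).mp hL N
  have h1 := hM (max M K) (le_max_left _ _)
  have h2 := key N K (max M K) hK (le_max_right _ _)
  have := Ideal.sub_mem _ h1 h2
  simpa using this

end SkewSetup

namespace SkewPowerSeries

open SkewSetup

variable {R : Type*} [Ring R] {i : Ideal R} [i.IsTwoSided] {τ : R ≃+* R} {δ : R →+ R}
  {h : SkewSetup i τ δ}

instance : Zero (SkewPowerSeries h) := ⟨⟨0⟩⟩
instance : Add (SkewPowerSeries h) := ⟨fun f g => ⟨f.coeff + g.coeff⟩⟩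
instance : Neg (SkewPowerSeries h) := ⟨fun f => ⟨-f.coeff⟩⟩
instance : One (SkewPowerSeries h) := ⟨⟨fun n => if n = 0 then 1 else 0⟩⟩

/-- `(∑ a_m y^m) (∑ b_j y^j) = ∑_n (∑_{j ≤ n} ∑_{m = 0}^∞ a_m θ_{m,n-j}(b_j)) y^n`. -/
noncomputable instance : Mul (SkewPowerSeries h) :=
  ⟨fun f g => ⟨fun n => ∑ j ∈ Finset.range (n + 1),
    adicSum i (fun m => f.coeff m * skewTheta τ δ m (n - j) (g.coeff j))⟩⟩

theorem coeff_mul (f g : SkewPowerSeries h) (n : ℕ) :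
    (f * g).coeff n = ∑ j ∈ Finset.range (n + 1),
      adicSum i (fun m => f.coeff m * skewTheta τ δ m (n - j) (g.coeff j)) := rfl

@[simp] theorem coeff_zero (n : ℕ) : (0 : SkewPowerSeries h).coeff n = 0 := rfl
@[simp] theorem coeff_add (f g : SkewPowerSeries h) (n : ℕ) :
    (f + g).coeff n = f.coeff n + g.coeff n := rfl
@[simp] theorem coeff_neg (f : SkewPowerSeries h) (n : ℕ) : (-f).coeff n = -f.coeff n := rfl
theorem coeff_one (n : ℕ) : (1 : SkewPowerSeries h).coeff n = if n = 0 then 1 else 0 := rfl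

theorem mul_approx (f g : SkewPowerSeries h) (N n K : ℕ) (hK : N + n ≤ K) :
    ∑ m ∈ Finset.range K, f.coeff m * (leftY τ δ)^[m] g.coeff n - (f * g).coeff n ∈ i ^ N := by
  have e : ∑ m ∈ Finset.range K, f.coeff m * (leftY τ δ)^[m] g.coeff n =
      ∑ j ∈ Finset.range (n + 1), ∑ m ∈ Finset.range K,
        f.coeff m * skewTheta τ δ m (n - j) (g.coeff j) := by
    rw [Finset.sum_comm]
    refine Finset.sum_congr rfl fun m _ => ?_
    rw [leftY_iter, Finset.mul_sum]
  rw [e, coeff_mul, ← Finset.sum_sub_distrib]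
  refine Ideal.sum_mem _ fun j _ => h.adicSum_approx _ (n - j) (fun m => ?_) N K (by omega)
  exact Ideal.mul_mem_left _ _ (h.theta_mem _ _ _)

theorem coeff_mul_eq {f g : SkewPowerSeries h} {n : ℕ} {x : R}
    (hx : ∀ N, ∃ K, N + n ≤ K ∧
      ∑ m ∈ Finset.range K, f.coeff m * (leftY τ δ)^[m] g.coeff n - x ∈ i ^ N) :
    (f * g).coeff n = x := by
  refine h.eq_of_mod fun N => ?_
  obtain ⟨K, hK, hx⟩ := hx N
  have := Ideal.sub_mem _ hx (mul_approx f g N n K hK)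
  simpa using this

theorem leftY_add (a b : ℕ → R) : leftY τ δ (a + b) = leftY τ δ a + leftY τ δ b := by
  funext n
  rcases n with _ | n
  · simp [leftY]
  · simp [leftY]; abel

theorem iter_add (a b : ℕ → R) (m : ℕ) :
    (leftY τ δ)^[m] (a + b) = (leftY τ δ)^[m] a + (leftY τ δ)^[m] b := by
  induction m with
  | zero => rfl
  | succ m ih => simp only [Function.iterate_succ_apply', ih, leftY_add]

theorem iter_mod (h : SkewSetup i τ δ) (a b : ℕ → R) (N m n : ℕ)
    (hab : ∀ k ≤ n, a k - b k ∈ i ^ N) :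
    (leftY τ δ)^[m] a n - (leftY τ δ)^[m] b n ∈ i ^ N := by
  induction m generalizing n with
  | zero => exact hab n le_rfl
  | succ m ih =>
    simp only [Function.iterate_succ_apply']
    have hd : ∀ k ≤ n, δ ((leftY τ δ)^[m] a k) - δ ((leftY τ δ)^[m] b k) ∈ i ^ N := by
      intro k hk
      rw [← map_sub]
      exact Ideal.pow_le_pow_right (Nat.le_succ N)
        (h.delta_pow _ _ (ih k fun l hl => hab l (hl.trans hk)))
    rcases n with _ | n
    · exact hd 0 le_rfl
    · have ht := h.tau_pow _ _ (ih n fun l hl => hab l (hl.trans n.le_succ))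
      rw [map_sub] at ht
      have := Ideal.add_mem _ ht (hd (n + 1) le_rfl)
      simpa only [leftY, add_sub_add_comm] using this

/-- `y ^ m * (r * g) = ∑_l θ_{m,l}(r) y ^ l * g`. -/
theorem iter_smul (h : SkewSetup i τ δ) (r : R) (g : ℕ → R) (m : ℕ) : ∀ n,
    (leftY τ δ)^[m] (fun k => r * g k) n =
      ∑ l ∈ Finset.range (m + 1), skewTheta τ δ m l r * (leftY τ δ)^[l] g n := by
  induction m with
  | zero => intro n; simp [skewTheta]
  | succ m ih =>
    have hY : ∀ (c : ℕ → R) (G : ℕ → ℕ → R) (L n : ℕ),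
        leftY τ δ (fun n => ∑ l ∈ Finset.range L, c l * G l n) n =
        ∑ l ∈ Finset.range L, (τ (c l) * leftY τ δ (G l) n + δ (c l) * G l n) := by
      intro c G L n
      rcases n with _ | n
      · simp [leftY, map_sum, h.leibniz]
      · simp only [leftY, map_sum, h.leibniz, map_mul, ← Finset.sum_add_distrib]
        exact Finset.sum_congr rfl fun l _ => by rw [mul_add]; abel
    intro n
    rw [Function.iterate_succ_apply', show (leftY τ δ)^[m] (fun k => r * g k) = _ from funext ih,
      hY, Finset.sum_add_distrib, Finset.sum_range_succ' _ (m + 1)]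
    have e1 : ∑ k ∈ Finset.range (m + 1),
        skewTheta τ δ (m + 1) (k + 1) r * (leftY τ δ)^[k + 1] g n =
        ∑ k ∈ Finset.range (m + 1), τ (skewTheta τ δ m k r) * (leftY τ δ)^[k + 1] g n +
        ∑ k ∈ Finset.range (m + 1),
          δ (skewTheta τ δ m (k + 1) r) * (leftY τ δ)^[k + 1] g n := by
      rw [← Finset.sum_add_distrib]
      refine Finset.sum_congr rfl fun k _ => ?_
      rw [← add_mul]
      rfl
    have e2 : ∑ k ∈ Finset.range (m + 1), δ (skewTheta τ δ m k r) * (leftY τ δ)^[k] g n =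
        ∑ k ∈ Finset.range (m + 1),
          δ (skewTheta τ δ m (k + 1) r) * (leftY τ δ)^[k + 1] g n +
        skewTheta τ δ (m + 1) 0 r * (leftY τ δ)^[0] g n := by
      have := Finset.sum_range_succ
        (fun k => δ (skewTheta τ δ m k r) * (leftY τ δ)^[k] g n) (m + 1)
      rw [Finset.sum_range_succ' _ (m + 1)] at this
      have z : skewTheta τ δ m (m + 1) = 0 := theta_eq_zero τ δ m (m + 1) (Nat.lt_succ_self m)
      rw [z] at this
      simp only [AddMonoidHom.zero_apply, map_zero, zero_mul, add_zero] at this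
      rw [← this]
      rfl
    rw [e1, e2, add_assoc]
    simp only [Function.iterate_succ_apply']

theorem iter_one (h : SkewSetup i τ δ) (m n : ℕ) :
    (leftY τ δ)^[m] (fun k => if k = 0 then (1 : R) else 0) n = if n = m then 1 else 0 := by
  induction m generalizing n with
  | zero => rfl
  | succ m ih =>
    rw [Function.iterate_succ_apply']
    rcases n with _ | n
    · simp only [leftY, ih]
      split_ifs <;> simp_all [h.delta_one]
    · simp only [leftY, ih]
      split_ifs <;> simp_all [h.delta_one]

theorem iter_sum (K : ℕ) (G : ℕ → ℕ → R) (m n : ℕ) :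
    (leftY τ δ)^[m] (fun p => ∑ k ∈ Finset.range K, G k p) n =
      ∑ k ∈ Finset.range K, (leftY τ δ)^[m] (G k) n := by
  simp only [leftY_iter, map_sum]
  rw [Finset.sum_comm]

/-- The key congruence behind associativity. -/
theorem assoc_approx (f g : SkewPowerSeries h) (N n m : ℕ) :
    ∑ k ∈ Finset.range (N + n), (leftY τ δ)^[m] f.coeff k * (leftY τ δ)^[k] g.coeff n -
      (leftY τ δ)^[m] (f * g).coeff n ∈ i ^ N := by
  set K := N + n with hKdef
  set F : ℕ → ℕ → R := fun j l =>
    skewTheta τ δ m l (f.coeff j) * (leftY τ δ)^[l + j] g.coeff n with hF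
  have e1 : ∑ k ∈ Finset.range K, (leftY τ δ)^[m] f.coeff k * (leftY τ δ)^[k] g.coeff n =
      ∑ j ∈ Finset.range K, ∑ l ∈ Finset.range (K - j), F j l := by
    rw [← Finset.sum_range_diag_flip]
    refine Finset.sum_congr rfl fun k _ => ?_
    rw [leftY_iter, Finset.sum_mul]
    refine Finset.sum_congr rfl fun j hj => ?_
    have : k - j + j = k := by have := Finset.mem_range.mp hj; omega
    simp only [hF, this]
  have e2 : (leftY τ δ)^[m]
      (fun p => ∑ j ∈ Finset.range K, f.coeff j * (leftY τ δ)^[j] g.coeff p) n =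
      ∑ j ∈ Finset.range K, ∑ l ∈ Finset.range (m + 1), F j l := by
    rw [iter_sum]
    refine Finset.sum_congr rfl fun j _ => ?_
    rw [iter_smul h]
    simp only [hF, Function.iterate_add_apply]
  have h3 : (leftY τ δ)^[m]
      (fun p => ∑ j ∈ Finset.range K, f.coeff j * (leftY τ δ)^[j] g.coeff p) n -
      (leftY τ δ)^[m] (f * g).coeff n ∈ i ^ N :=
    iter_mod h _ _ N m n fun p hp => mul_approx f g N p K (by omega)
  have h4 : ∑ j ∈ Finset.range K, ∑ l ∈ Finset.range (K - j), F j l -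
      ∑ j ∈ Finset.range K, ∑ l ∈ Finset.range (m + 1), F j l ∈ i ^ N := by
    rw [← Finset.sum_sub_distrib]
    refine Ideal.sum_mem _ fun j _ => ?_
    have a : ∑ l ∈ Finset.range (m + 1), F j l =
        ∑ l ∈ Finset.range (max (K - j) (m + 1)), F j l := by
      refine Finset.sum_subset (Finset.range_mono (le_max_right _ _)) fun l _ hl => ?_
      have : m < l := by simpa using hl
      simp [hF, theta_eq_zero τ δ m l this]
    rw [a, ← neg_sub, ← Finset.sum_Ico_eq_sub _ (le_max_left _ _)]
    refine (Ideal.neg_mem_iff _).mpr (Ideal.sum_mem _ fun l hl => ?_)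
    have := (Finset.mem_Ico.mp hl).1
    exact Ideal.mul_mem_left _ _
      (Ideal.pow_le_pow_right (by omega) (h.leftY_iter_mem g.coeff (l + j) n))
  rw [e1]
  rw [e2] at h3
  have := Ideal.add_mem _ h4 h3
  simpa using this

theorem mul_assoc' (f g k : SkewPowerSeries h) : f * g * k = f * (g * k) := by
  ext n
  refine coeff_mul_eq fun N => ⟨N + n, le_rfl, ?_⟩
  set K := N + n
  set L := N + K
  have h1 : ∑ p ∈ Finset.range K, (f * g).coeff p * (leftY τ δ)^[p] k.coeff n -
      ∑ p ∈ Finset.range K, (∑ m ∈ Finset.range L, f.coeff m * (leftY τ δ)^[m] g.coeff p) *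
        (leftY τ δ)^[p] k.coeff n ∈ i ^ N := by
    rw [← Finset.sum_sub_distrib]
    refine Ideal.sum_mem _ fun p hp => ?_
    rw [← sub_mul, ← neg_sub]
    have := Finset.mem_range.mp hp
    exact Ideal.mul_mem_right _ _
      ((Ideal.neg_mem_iff _).mpr (mul_approx f g N p L (by omega)))
  have e2 : ∑ p ∈ Finset.range K, (∑ m ∈ Finset.range L, f.coeff m * (leftY τ δ)^[m] g.coeff p) *
        (leftY τ δ)^[p] k.coeff n =
      ∑ m ∈ Finset.range L, f.coeff m *
        ∑ p ∈ Finset.range K, (leftY τ δ)^[m] g.coeff p * (leftY τ δ)^[p] k.coeff n := by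
    simp only [Finset.sum_mul, Finset.mul_sum, mul_assoc]
    rw [Finset.sum_comm]
  have h3 : ∑ m ∈ Finset.range L, f.coeff m *
        ∑ p ∈ Finset.range K, (leftY τ δ)^[m] g.coeff p * (leftY τ δ)^[p] k.coeff n -
      ∑ m ∈ Finset.range L, f.coeff m * (leftY τ δ)^[m] (g * k).coeff n ∈ i ^ N := by
    rw [← Finset.sum_sub_distrib]
    refine Ideal.sum_mem _ fun m _ => ?_
    rw [← mul_sub]
    exact Ideal.mul_mem_left _ _ (assoc_approx g k N n m)
  have h4 := mul_approx f (g * k) N n L (by omega)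
  rw [e2] at h1
  have := Ideal.add_mem _ (Ideal.add_mem _ h1 h3) h4
  simpa using this

theorem mul_add' (f g k : SkewPowerSeries h) : f * (g + k) = f * g + f * k := by
  ext n
  refine coeff_mul_eq fun N => ⟨N + n, le_rfl, ?_⟩
  have := Ideal.add_mem _ (mul_approx f g N n _ le_rfl) (mul_approx f k N n _ le_rfl)
  rw [sub_add_sub_comm, ← Finset.sum_add_distrib] at this
  simp only [← mul_add] at this
  have e : (g + k).coeff = g.coeff + k.coeff := rfl
  simpa only [e, iter_add, Pi.add_apply, coeff_add] using this

theorem add_mul' (f g k : SkewPowerSeries h) : (f + g) * k = f * k + g * k := by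
  ext n
  refine coeff_mul_eq fun N => ⟨N + n, le_rfl, ?_⟩
  have := Ideal.add_mem _ (mul_approx f k N n _ le_rfl) (mul_approx g k N n _ le_rfl)
  rw [sub_add_sub_comm, ← Finset.sum_add_distrib] at this
  simpa only [coeff_add, add_mul] using this

theorem one_mul' (f : SkewPowerSeries h) : 1 * f = f := by
  ext n
  refine coeff_mul_eq fun N => ⟨N + n + 1, by omega, ?_⟩
  have : ∑ m ∈ Finset.range (N + n + 1),
      (1 : SkewPowerSeries h).coeff m * (leftY τ δ)^[m] f.coeff n = f.coeff n := by
    rw [Finset.sum_eq_single 0]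
    · simp [coeff_one]
    · intro m _ hm
      simp [coeff_one, hm]
    · intro hm
      simp at hm
  simp [this]

theorem mul_one' (f : SkewPowerSeries h) : f * 1 = f := by
  ext n
  refine coeff_mul_eq fun N => ⟨N + n + 1, by omega, ?_⟩
  have e : (1 : SkewPowerSeries h).coeff = fun k => if k = 0 then (1 : R) else 0 := rfl
  simp [e, iter_one h]

/-- The skew power series ring `T = R[[y; τ, δ]]`. -/
noncomputable instance : Ring (SkewPowerSeries h) :=
  Ring.ofMinimalAxioms
    (fun a b c => by ext n; simp [add_assoc])
    (fun a => by ext n; simp)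
    (fun a => by ext n; simp)
    mul_assoc' one_mul' mul_one' mul_add' add_mul'

/-- The inclusion `R ⊆ T` of the constant series. -/
def C (h : SkewSetup i τ δ) (r : R) : SkewPowerSeries h := ⟨fun n => if n = 0 then r else 0⟩

/-- The series `y`. -/
def Y (h : SkewSetup i τ δ) : SkewPowerSeries h := ⟨fun n => if n = 1 then 1 else 0⟩

/-- The skew polynomial ring `S = R[y; τ, δ]`, as the subring of `T` of the series with only
finitely many nonzero coefficients. -/
def polySubring (h : SkewSetup i τ δ) : Subring (SkewPowerSeries h) where
  carrier := {f | ∃ p : ℕ, ∀ n, p ≤ n → f.coeff n = 0}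
  zero_mem' := ⟨0, fun _ _ => rfl⟩
  one_mem' := ⟨1, fun n hn => by
    rw [coeff_one, if_neg (Nat.one_le_iff_ne_zero.mp hn)]⟩
  add_mem' := by
    rintro f g ⟨p, hp⟩ ⟨q, hq⟩
    refine ⟨max p q, fun n hn => ?_⟩
    simp [hp n (le_trans (le_max_left _ _) hn), hq n (le_trans (le_max_right _ _) hn)]
  neg_mem' := by
    rintro f ⟨p, hp⟩
    exact ⟨p, fun n hn => by simp [hp n hn]⟩
  mul_mem' := by
    rintro f g ⟨p, hp⟩ ⟨q, hq⟩
    refine ⟨p + q, fun n hn => coeff_mul_eq fun N => ⟨N + n, le_rfl, ?_⟩⟩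
    rw [Finset.sum_eq_zero, sub_zero]
    · exact Ideal.zero_mem _
    · intro m _
      rcases le_or_gt p m with hm | hm
      · rw [hp m hm, zero_mul]
      · rw [SkewSetup.leftY_iter, Finset.sum_eq_zero, mul_zero]
        intro j _
        rcases le_or_gt q j with hj | hj
        · rw [hq j hj, map_zero]
        · rw [theta_eq_zero τ δ m (n - j) (by omega)]
          rfl

/-- The two-sided ideal `j` of `T` generated by `i` and `y`. -/
noncomputable def jIdeal (h : SkewSetup i τ δ) : Ideal (SkewPowerSeries h) :=
  (TwoSidedIdeal.span (C h '' (i : Set R) ∪ {Y h})).asIdeal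

instance (h : SkewSetup i τ δ) : (jIdeal h).IsTwoSided :=
  inferInstanceAs (TwoSidedIdeal.asIdeal _).IsTwoSided

/-- `I[[y; τ, δ]]`: the set of series `∑ a_n y ^ n` with all `a_n ∈ I`. -/
def leftSeries (h : SkewSetup i τ δ) (I : Ideal R) : Set (SkewPowerSeries h) :=
  {f | ∀ n, f.coeff n ∈ I}

/-- `f = ∑ y ^ n b_n`, a series with coefficients on the right: `f` is the limit of the partial
sums in the `j`-adic topology of `T`. -/
def IsRightSeries (h : SkewSetup i τ δ) (b : ℕ → R) (f : SkewPowerSeries h) : Prop :=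
  AdicTendsto (jIdeal h) (fun m => ∑ n ∈ Finset.range m, Y h ^ n * C h (b n)) f

/-- The set of series `∑ y ^ n b_n` with all `b_n ∈ I`. -/
def rightSeries (h : SkewSetup i τ δ) (I : Ideal R) : Set (SkewPowerSeries h) :=
  {f | ∃ b : ℕ → R, (∀ n, b n ∈ I) ∧ IsRightSeries h b f}

end SkewPowerSeries

/-- The set `UV` of all finite sums of products `u v` with `u ∈ U` and `v ∈ V`. -/
def sumsOfProducts {A : Type*} [Ring A] (U V : Set A) : AddSubgroup A :=
  AddSubgroup.closure {x | ∃ u ∈ U, ∃ v ∈ V, x = u * v}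

/-! ### `τ`-`δ`-ideals and the induced maps on the quotient -/

/-- A (two-sided) ideal `I` is a `τ`-`δ`-ideal if `τ(I) = I` and `δ(I) ⊆ I`. -/
structure IsTauDeltaIdeal {R : Type*} [Ring R] (τ : R ≃+* R) (δ : R →+ R) (I : Ideal R) :
    Prop where
  map_tau : τ '' (I : Set R) = I
  delta_mem : ∀ a ∈ I, δ a ∈ I

namespace IsTauDeltaIdeal

variable {R : Type*} [Ring R] {τ : R ≃+* R} {δ : R →+ R} {I : Ideal R}

theorem eq_map (hI : IsTauDeltaIdeal τ δ I) : I = I.map (τ : R →+* R) := by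
  rw [Ideal.map]
  change I = Ideal.span (τ '' (I : Set R))
  rw [hI.map_tau, Ideal.span_eq]

variable [I.IsTwoSided]

/-- The automorphism of `R/I` induced by `τ`. -/
def quotTau (hI : IsTauDeltaIdeal τ δ I) : (R ⧸ I) ≃+* (R ⧸ I) :=
  Ideal.quotientEquiv I I τ hI.eq_map

/-- The additive map on `R/I` induced by `δ`. -/
def quotDelta (hI : IsTauDeltaIdeal τ δ I) : (R ⧸ I) →+ (R ⧸ I) :=
  QuotientAddGroup.map I.toAddSubgroup I.toAddSubgroup δ (fun a ha => hI.delta_mem a ha)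

theorem quotTau_mk (hI : IsTauDeltaIdeal τ δ I) (r : R) :
    hI.quotTau (Ideal.Quotient.mk I r) = Ideal.Quotient.mk I (τ r) := rfl

theorem quotDelta_mk (hI : IsTauDeltaIdeal τ δ I) (r : R) :
    hI.quotDelta (Ideal.Quotient.mk I r) = Ideal.Quotient.mk I (δ r) := rfl

end IsTauDeltaIdeal

/-! Everything rests on one fact about `R`: since `gr R` is noetherian on both sides and `R` is
separated and complete, `I` is closed and is finitely generated both as a left and as a right ideal.
The leading forms of elements of `I` make up an ideal whose image in `gr R` is finitely generated.
Lifting its generators to `I` and dividing degree by degree produces coefficients that converge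
(`exists_eq_sum_of_approx`), so even an element of the closure of `I` is a combination of the chosen
generators.

In `T`, membership in the `n`-th power of `j` means that the `k`-th coefficient lies in `i ^ (n -
k)` (`mem_jIdeal_pow_iff`), so `j`-adic limits are coefficientwise limits with controlled rates.
Reading `y r = τ(r) y + δ(r)` backwards gives `r y = y τ⁻¹(r) - δ(τ⁻¹(r))`. Hence powers of `y` can
be moved to either side, and every series has both a left and a right expansion; closedness of `I`
keeps the new coefficients, which are infinite sums, inside `I`. For the same reason `I[[y; τ, δ]]`
is a two-sided ideal and closed, and truncation shows that it is the closure of its polynomials,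
which form both `IS` and `SI`.

For `IT`, write all left coefficients of a series over the same finite set of right ideal generators
`x_k`, and collect the cofactors of each `x_k` into one series. For `TI`, do this with right
coefficients and left ideal generators. Finally, separation of `R/I` is closedness of `I`,
completeness and the noetherian conditions descend along the surjection, and coefficientwise
reduction is a surjective homomorphism with kernel `I[[y; τ, δ]]`. -/

/-! ### Generators of ideals from leading forms -/

section Generators

/-- An ideal of `P` is finitely generated modulo the kernel of a surjection onto a noetherian
ring. -/
theorem exists_fin_generators_mod {P Q : Type*} [Ring P] [Ring Q] [IsNoetherianRing Q]
    (π : P →+* Q) (hπ : Function.Surjective π) (K : Ideal P) :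
    ∃ (p : ℕ) (f : Fin p → P), (∀ k, f k ∈ K) ∧
      ∀ g ∈ K, ∃ c : Fin p → P, π g = π (∑ k, c k * f k) := by
  obtain ⟨p, s, hs⟩ := Submodule.fg_iff_exists_fin_generating_family.mp
    (IsNoetherian.noetherian (K.map π))
  have hmem : ∀ k, ∃ f ∈ K, π f = s k := fun k => by
    rw [← Ideal.mem_map_iff_of_surjective π hπ, ← hs]
    exact Submodule.subset_span ⟨k, rfl⟩
  choose f hf hfs using hmem
  refine ⟨p, f, hf, fun g hg => ?_⟩
  have h1 : π g ∈ Submodule.span Q (Set.range s) := by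
    rw [hs]
    exact Ideal.mem_map_of_mem π hg
  obtain ⟨c, hc⟩ := (Submodule.mem_span_range_iff_exists_fun Q).mp h1
  choose c' hc' using fun k => hπ (c k)
  refine ⟨c', ?_⟩
  rw [← hc, map_sum]
  simp [hc', hfs]

/-! ### Coefficients of products of polynomials of bounded degree -/

open Polynomial

variable {A : Type*} [Ring A]

/-- The index set `Fin D` does not depend on `n`, so the same finite family of generators can serve
in every degree. The `if` discards `b > n`, where truncated subtraction would produce a spurious
`c.coeff 0`. -/
theorem Polynomial.coeff_mul_eq_sum_fin_right (c f : A[X]) (D n : ℕ)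
    (hD : ∀ b, D ≤ b → f.coeff b = 0) :
    (c * f).coeff n =
      ∑ b : Fin D, (if (b : ℕ) ≤ n then c.coeff (n - b) else 0) * f.coeff b := by
  rw [← Finset.sum_range fun b => (if b ≤ n then c.coeff (n - b) else 0) * f.coeff b,
    Polynomial.coeff_mul, ← Finset.Nat.sum_antidiagonal_swap]
  simp only [Prod.fst_swap, Prod.snd_swap]
  rw [Finset.Nat.sum_antidiagonal_eq_sum_range_succ (fun b a => c.coeff a * f.coeff b)]
  simp only [ite_mul, zero_mul]
  rw [← Finset.sum_filter]
  symm
  refine Finset.sum_subset (fun b hb => ?_) fun b hb hb' => ?_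
  · have := (Finset.mem_filter.mp hb).2
    simp; omega
  · rw [hD b, mul_zero]
    simp at hb hb'
    omega

theorem Polynomial.coeff_mul_eq_sum_fin_left (f c : A[X]) (D n : ℕ)
    (hD : ∀ b, D ≤ b → f.coeff b = 0) :
    (f * c).coeff n =
      ∑ b : Fin D, f.coeff b * (if (b : ℕ) ≤ n then c.coeff (n - b) else 0) := by
  rw [← Finset.sum_range fun b => f.coeff b * (if b ≤ n then c.coeff (n - b) else 0),
    Polynomial.coeff_mul,
    Finset.Nat.sum_antidiagonal_eq_sum_range_succ (fun b a => f.coeff b * c.coeff a)]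
  simp only [mul_ite, mul_zero]
  rw [← Finset.sum_filter]
  symm
  refine Finset.sum_subset (fun b hb => ?_) fun b hb hb' => ?_
  · have := (Finset.mem_filter.mp hb).2
    simp; omega
  · rw [hD b, zero_mul]
    simp at hb hb'
    omega

theorem Polynomial.exists_coeff_eq_zero_of_le {p : ℕ} (f : Fin p → A[X]) :
    ∃ D, ∀ k b, D ≤ b → (f k).coeff b = 0 := by
  refine ⟨(∑ k, (f k).natDegree) + 1,
    fun k b hb => Polynomial.coeff_eq_zero_of_natDegree_lt ?_⟩
  have := Finset.single_le_sum (f := fun k => (f k).natDegree) (fun _ _ => Nat.zero_le _)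
    (Finset.mem_univ k)
  omega

/-! ### Leading forms in the Rees ring -/

variable (J I : Ideal A) [J.IsTwoSided]

/-- The ideal of the Rees ring of the elements whose coefficients are leading forms of elements
of `I`. -/
def leadingForms : Ideal (reesRing J) where
  carrier := {f | ∀ n, ∃ z ∈ I, f.1.coeff n - z ∈ J ^ (n + 1)}
  zero_mem' n := ⟨0, I.zero_mem, by simp⟩
  add_mem' {f g} hf hg n := by
    obtain ⟨z, hz, hz'⟩ := hf n
    obtain ⟨w, hw, hw'⟩ := hg n
    refine ⟨z + w, I.add_mem hz hw, ?_⟩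
    have : (f + g).1.coeff n = f.1.coeff n + g.1.coeff n := by simp
    rw [this, add_sub_add_comm]
    exact Ideal.add_mem _ hz' hw'
  smul_mem' c f hf n := by
    choose z hz hz' using hf
    refine ⟨∑ q ∈ Finset.HasAntidiagonal.antidiagonal n, c.1.coeff q.1 * z q.2,
      I.sum_mem fun q _ => I.mul_mem_left _ (hz _), ?_⟩
    have : (c • f).1 = c.1 * f.1 := rfl
    rw [this, Polynomial.coeff_mul, ← Finset.sum_sub_distrib]
    refine Ideal.sum_mem _ fun q hq => ?_
    rw [← mul_sub, ← Finset.HasAntidiagonal.mem_antidiagonal.mp hq, add_assoc,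
      Ideal.IsTwoSided.pow_add]
    exact Ideal.mul_mem_mul (c.2 _) (hz' _)

instance [I.IsTwoSided] : (leadingForms J I).IsTwoSided where
  mul_mem_of_left {f} c hf n := by
    choose z hz hz' using hf
    refine ⟨∑ q ∈ Finset.HasAntidiagonal.antidiagonal n, z q.1 * c.1.coeff q.2,
      I.sum_mem fun q _ => I.mul_mem_right _ (hz _), ?_⟩
    have : (f * c).1 = f.1 * c.1 := rfl
    rw [this, Polynomial.coeff_mul, ← Finset.sum_sub_distrib]
    refine Ideal.sum_mem _ fun q hq => ?_
    rw [← sub_mul, ← Finset.HasAntidiagonal.mem_antidiagonal.mp hq, add_right_comm,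
      Ideal.IsTwoSided.pow_add]
    exact Ideal.mul_mem_mul (hz' _) (c.2 _)

variable {J I}

/-- The monomial `z X ^ n` of the Rees ring. -/
noncomputable def reesMonomial {n : ℕ} {z : A} (hz : z ∈ J ^ n) : reesRing J :=
  ⟨monomial n z, fun m => by
    rw [Polynomial.coeff_monomial]
    split_ifs with e
    · exact e ▸ hz
    · exact Ideal.zero_mem _⟩

theorem reesMonomial_mem_leadingForms {n : ℕ} {z : A} (hz : z ∈ J ^ n) (hI : z ∈ I) :
    reesMonomial hz ∈ leadingForms J I := fun m => by
  refine ⟨(monomial n z).coeff m, ?_, ?_⟩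
  · rw [Polynomial.coeff_monomial]
    split_ifs
    · exact hI
    · exact I.zero_mem
  · change (monomial n z).coeff m - _ ∈ _
    rw [sub_self]
    exact Ideal.zero_mem _

/-- Translates an identity in the associated graded ring back into a congruence in `A`. -/
theorem coeff_reesMonomial_sub_mem {n : ℕ} {z : A} (hz : z ∈ J ^ n) {g : reesRing J}
    (e : Ideal.Quotient.mk (reesShift J) (reesMonomial hz) = Ideal.Quotient.mk (reesShift J) g) :
    z - g.1.coeff n ∈ J ^ (n + 1) := by
  have h1 : (reesMonomial hz - g).1.coeff n ∈ J ^ (n + 1) := (Ideal.Quotient.eq.mp e) n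
  have h2 : (reesMonomial hz - g).1 = monomial n z - g.1 := rfl
  rw [h2, Polynomial.coeff_sub, Polynomial.coeff_monomial_same] at h1
  exact h1

variable (J I)

/-- Choose finitely many `f k` generating the leading forms modulo `reesShift J`. They need not be
homogeneous, so each coefficient of each `f k` is lifted to `I` separately, whence the pairs `(k,
b)`. Expressing the monomial of `z` through the `f k` and comparing coefficients in degree `n` gives
the division. Its cofactors lose at most `b` degrees, a loss independent of `n`. -/
theorem exists_leading_generators_left [IsNoetherianRing (AssocGraded J)] :
    ∃ (p D : ℕ) (x : Fin p × Fin D → A), (∀ k, x k ∈ I) ∧ ∀ n, ∀ z ∈ I, z ∈ J ^ n →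
      ∃ r : Fin p × Fin D → A, (∀ k, r k ∈ J ^ (n - (k.2 : ℕ))) ∧
        z - ∑ k, r k * x k ∈ J ^ (n + 1) := by
  obtain ⟨p, f, hf, hgen⟩ := exists_fin_generators_mod (Ideal.Quotient.mk (reesShift J))
    Ideal.Quotient.mk_surjective (leadingForms J I)
  obtain ⟨D, hD⟩ := Polynomial.exists_coeff_eq_zero_of_le fun k => (f k).1
  choose x hxI hx using hf
  refine ⟨p, D, fun k => x k.1 k.2, fun k => hxI _ _, fun n z hz hzn => ?_⟩
  obtain ⟨c, hc⟩ := hgen _ (reesMonomial_mem_leadingForms hzn hz)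
  have h1 := coeff_reesMonomial_sub_mem hzn hc
  have e : (∑ k, c k * f k).1 = ∑ k, (c k).1 * (f k).1 := by simp
  refine ⟨fun k => if (k.2 : ℕ) ≤ n then (c k.1).1.coeff (n - k.2) else 0, fun k => ?_, ?_⟩
  · dsimp only
    split_ifs
    · exact (c k.1).2 (n - k.2)
    · exact Ideal.zero_mem _
  · rw [e, Polynomial.finsetSum_coeff] at h1
    simp_rw [fun k => Polynomial.coeff_mul_eq_sum_fin_right (c k).1 (f k).1 D n (hD k)] at h1
    -- The first part is the congruence in degree `n`; the second is the cost of replacing the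
    -- coefficients of `f k` by their lifts, a factor in `J ^ (b + 1)` times a cofactor in `J ^ (n -
    -- b)`.
    rw [← sub_add_sub_cancel]
    refine Ideal.add_mem _ h1 ?_
    rw [Fintype.sum_prod_type, ← Finset.sum_sub_distrib]
    refine Ideal.sum_mem _ fun k _ => ?_
    rw [← Finset.sum_sub_distrib]
    refine Ideal.sum_mem _ fun b _ => ?_
    rw [← mul_sub]
    split_ifs with hb
    · rw [show n + 1 = (n - b) + (b + 1) by omega, Ideal.IsTwoSided.pow_add]
      exact Ideal.mul_mem_mul ((c k).2 _) (hx _ _)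
    · simp

theorem exists_leading_generators_right [I.IsTwoSided] [IsNoetherianRing (AssocGraded J)ᵐᵒᵖ] :
    ∃ (p D : ℕ) (x : Fin p × Fin D → A), (∀ k, x k ∈ I) ∧ ∀ n, ∀ z ∈ I, z ∈ J ^ n →
      ∃ r : Fin p × Fin D → A, (∀ k, r k ∈ J ^ (n - (k.2 : ℕ))) ∧
        z - ∑ k, x k * r k ∈ J ^ (n + 1) := by
  -- The leading forms as a left ideal of the opposite ring; closure under its scalars uses that
  -- they form a two-sided ideal.
  let K : Ideal (reesRing J)ᵐᵒᵖ :=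
    { carrier := {f | f.unop ∈ leadingForms J I}
      zero_mem' := (leadingForms J I).zero_mem
      add_mem' := fun hf hg => (leadingForms J I).add_mem hf hg
      smul_mem' := fun c f hf => Ideal.mul_mem_right _ (leadingForms J I) hf }
  obtain ⟨p, f, hf, hgen⟩ := exists_fin_generators_mod
    (RingHom.op (Ideal.Quotient.mk (reesShift J)))
    (fun y => by
      obtain ⟨x, hx⟩ := Ideal.Quotient.mk_surjective y.unop
      exact ⟨MulOpposite.op x, MulOpposite.unop_injective hx⟩) K
  obtain ⟨D, hD⟩ := Polynomial.exists_coeff_eq_zero_of_le fun k => (f k).unop.1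
  choose x hxI hx using hf
  refine ⟨p, D, fun k => x k.1 k.2, fun k => hxI _ _, fun n z hz hzn => ?_⟩
  obtain ⟨c, hc⟩ := hgen (MulOpposite.op (reesMonomial hzn))
    (reesMonomial_mem_leadingForms hzn hz)
  have h1 := coeff_reesMonomial_sub_mem hzn (MulOpposite.op_injective hc)
  have e : (∑ k, c k * f k).unop.1 = ∑ k, (f k).unop.1 * (c k).unop.1 := by simp
  refine ⟨fun k => if (k.2 : ℕ) ≤ n then (c k.1).unop.1.coeff (n - k.2) else 0,
    fun k => ?_, ?_⟩
  · dsimp only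
    split_ifs
    · exact (c k.1).unop.2 (n - k.2)
    · exact Ideal.zero_mem _
  · rw [e, Polynomial.finsetSum_coeff] at h1
    simp_rw [fun k =>
      Polynomial.coeff_mul_eq_sum_fin_left (f k).unop.1 (c k).unop.1 D n (hD k)] at h1
    rw [← sub_add_sub_cancel]
    refine Ideal.add_mem _ h1 ?_
    rw [Fintype.sum_prod_type, ← Finset.sum_sub_distrib]
    refine Ideal.sum_mem _ fun k _ => ?_
    rw [← Finset.sum_sub_distrib]
    refine Ideal.sum_mem _ fun b _ => ?_
    rw [← sub_mul]
    split_ifs with hb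
    · rw [show n + 1 = (b + 1) + (n - b) by omega, Ideal.IsTwoSided.pow_add]
      exact Ideal.mul_mem_mul (hx _ _) ((c k).unop.2 _)
    · simp

/-! ### Successive approximation: ideals are closed and finitely generated -/

variable {J I}

/-- If elements of `I` are approximated, degree by degree, by sums `∑ φ_k(r_k)`, then every
element of the closure of `I` is such a sum. -/
theorem exists_eq_sum_of_approx (hs : AdicSeparated J) (hc : AdicComplete J)
    {ι : Type*} [Fintype ι] (d : ι → ℕ) (φ : ι → A →+ A)
    (hφ : ∀ k n, ∀ r ∈ J ^ n, φ k r ∈ J ^ n) (hφI : ∀ k r, φ k r ∈ I)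
    (H : ∀ n, ∀ z ∈ I, z ∈ J ^ n → ∃ r : ι → A, (∀ k, r k ∈ J ^ (n - d k)) ∧
      z - ∑ k, φ k (r k) ∈ J ^ (n + 1))
    (y : A) (hy : ∀ n : ℕ, ∃ z ∈ I, y - z ∈ J ^ n) : ∃ r : ι → A, y = ∑ k, φ k (r k) := by
  have step : ∀ n (s : {s : ι → A // y - ∑ k, φ k (s k) ∈ J ^ n}),
      ∃ s' : {s : ι → A // y - ∑ k, φ k (s k) ∈ J ^ (n + 1)},
        ∀ k, s'.1 k - s.1 k ∈ J ^ (n - d k) := by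
    rintro n ⟨s, hs⟩
    -- `y` itself is not known to lie in `I`, so the division is applied to a `z ∈ I` agreeing with
    -- `y` modulo `J ^ (n + 1)`. The remainder of `z` then lies in `I` and in `J ^ n`.
    obtain ⟨z, hz, hyz⟩ := hy (n + 1)
    have hw : z - ∑ k, φ k (s k) ∈ I := I.sub_mem hz (I.sum_mem fun k _ => hφI k _)
    have hwn : z - ∑ k, φ k (s k) ∈ J ^ n := by
      have := Ideal.sub_mem _ hs (Ideal.pow_le_pow_right n.le_succ hyz)
      simpa using this
    obtain ⟨r, hr, hr'⟩ := H n _ hw hwn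
    refine ⟨⟨s + r, ?_⟩, fun k => by simpa using hr k⟩
    have := Ideal.add_mem _ hyz hr'
    simpa [Finset.sum_add_distrib, sub_sub] using this
  choose next hnext using step
  let s : ∀ n, {s : ι → A // y - ∑ k, φ k (s k) ∈ J ^ n} := fun n =>
    Nat.rec ⟨0, by simp [Submodule.pow_zero]⟩ next n
  have hsucc : ∀ n k, (s (n + 1)).1 k - (s n).1 k ∈ J ^ (n - d k) := fun n => hnext n (s n)
  -- The bounded loss `d k` only delays convergence of the `k`-th coefficient.
  have hcauchy : ∀ k N p q, N + d k ≤ p → p ≤ q → (s q).1 k - (s p).1 k ∈ J ^ N := by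
    intro k N p q hp hpq
    induction q, hpq using Nat.le_induction with
    | base => simp
    | succ q hq ih =>
      rw [← sub_add_sub_cancel _ ((s q).1 k)]
      exact Ideal.add_mem _ (Ideal.pow_le_pow_right (by omega) (hsucc q k)) ih
  have hlim : ∀ k, ∃ L, AdicTendsto J (fun n => (s n).1 k) L := fun k => by
    refine hc _ fun N => ⟨N + d k, fun p q hp hq => ?_⟩
    rcases le_total p q with hpq | hpq
    · rw [← neg_sub]
      exact (Ideal.neg_mem_iff _).mpr (hcauchy k N p q hp hpq)
    · exact hcauchy k N q p hq hpq
  choose L hL using hlim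
  refine ⟨L, sub_eq_zero.mp (hs _ fun N => ?_)⟩
  choose M hM using fun k => (adicTendsto_iff J _ _).mp (hL k) N
  have h1 := (s (N + ∑ k, M k)).2
  -- The stage `N + ∑ k, M k` is past every `M k`, and past `N` for the remainder.
  have h2 : ∑ k, φ k ((s (N + ∑ k, M k)).1 k - L k) ∈ J ^ N := by
    refine Ideal.sum_mem _ fun k _ => hφ _ _ _ (hM k _ ?_)
    have := Finset.single_le_sum (f := M) (fun _ _ => Nat.zero_le _) (Finset.mem_univ k)
    omega
  have := Ideal.add_mem _ (Ideal.pow_le_pow_right (by omega) h1) h2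
  simpa [Finset.sum_sub_distrib] using this

variable (I)

/-- Over a complete ring with left noetherian associated graded ring, a two-sided ideal is
finitely generated as a left ideal by elements that also generate its closure. -/
theorem exists_generators_left (hs : AdicSeparated J) (hc : AdicComplete J)
    (hn : IsNoetherianRing (AssocGraded J)) :
    ∃ (ι : Type) (_ : Fintype ι) (x : ι → A), (∀ k, x k ∈ I) ∧
      ∀ y, (∀ n : ℕ, ∃ z ∈ I, y - z ∈ J ^ n) → ∃ r : ι → A, y = ∑ k, r k * x k := by
  obtain ⟨p, D, x, hx, H⟩ := exists_leading_generators_left J I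
  exact ⟨_, inferInstance, x, hx, exists_eq_sum_of_approx hs hc (fun k => (k.2 : ℕ))
    (fun k => AddMonoidHom.mulRight (x k)) (fun k n r hr => (J ^ n).mul_mem_right _ hr)
    (fun k r => I.mul_mem_left _ (hx k)) H⟩

theorem exists_generators_right [I.IsTwoSided] (hs : AdicSeparated J) (hc : AdicComplete J)
    (hn : IsNoetherianRing (AssocGraded J)ᵐᵒᵖ) :
    ∃ (ι : Type) (_ : Fintype ι) (x : ι → A), (∀ k, x k ∈ I) ∧
      ∀ y, (∀ n : ℕ, ∃ z ∈ I, y - z ∈ J ^ n) → ∃ r : ι → A, y = ∑ k, x k * r k := by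
  obtain ⟨p, D, x, hx, H⟩ := exists_leading_generators_right J I
  exact ⟨_, inferInstance, x, hx, exists_eq_sum_of_approx hs hc (fun k => (k.2 : ℕ))
    (fun k => AddMonoidHom.mulLeft (x k)) (fun k n r hr => (J ^ n).mul_mem_left _ hr)
    (fun k r => I.mul_mem_right _ (hx k)) H⟩

end Generators

/-! ### The skew maps `θ` and the inverse skew derivation -/

section SkewTheta

variable {R : Type*} [Ring R]

/-- `θ_{m,k}` is a sum of words with `m - k` letters `δ`, each raising the degree by one. Only the
degree bounds are assumed, and no Leibniz rule, so that the result also covers the pair `τ⁻¹`, `-δ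
τ⁻¹`. -/
theorem skewTheta_mem_pow {i : Ideal R} {τ : R ≃+* R} {δ : R →+ R}
    (hτ : ∀ a, ∀ r ∈ i ^ a, τ r ∈ i ^ a) (hδ : ∀ a, ∀ r ∈ i ^ a, δ r ∈ i ^ (a + 1)) (m : ℕ) :
    ∀ k r, skewTheta τ δ m k r ∈ i ^ (m - k) := by
  induction m with
  | zero => intro k r; simp [Submodule.pow_zero]
  | succ m ih =>
    intro k r
    rcases k with _ | k
    · exact hδ _ _ (ih 0 r)
    · have e : m + 1 - (k + 1) = m - k := by omega
      rw [e]
      exact Ideal.add_mem _ (hτ _ _ (ih k r))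
        (Ideal.pow_le_pow_right (by omega) (hδ _ _ (ih (k + 1) r)))

theorem skewTheta_mem_ideal {I : Ideal R} {τ : R ≃+* R} {δ : R →+ R}
    (hτ : ∀ r ∈ I, τ r ∈ I) (hδ : ∀ r ∈ I, δ r ∈ I) (m : ℕ) :
    ∀ k, ∀ r ∈ I, skewTheta τ δ m k r ∈ I := by
  induction m with
  | zero =>
    intro k r hr
    rcases k with _ | k
    · exact hr
    · exact I.zero_mem
  | succ m ih =>
    intro k r hr
    rcases k with _ | k
    · exact hδ _ (ih 0 r hr)
    · exact I.add_mem (hτ _ (ih k r hr)) (hδ _ (ih (k + 1) r hr))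

/-- The map `δ' = -δ τ⁻¹`, for which `r y = y τ⁻¹(r) + δ'(r)`. -/
def invDelta (τ : R ≃+* R) (δ : R →+ R) : R →+ R := -δ.comp (τ.symm : R →+ R)

theorem invDelta_apply (τ : R ≃+* R) (δ : R →+ R) (r : R) :
    invDelta τ δ r = -δ (τ.symm r) := rfl

theorem RingEquiv.symm_mem_of_image_eq {τ : R ≃+* R} {I : Ideal R}
    (h : τ '' (I : Set R) = I) {r : R} (hr : r ∈ I) : τ.symm r ∈ I := by
  have : r ∈ τ '' (I : Set R) := by rw [h]; exact hr
  obtain ⟨s, hs, rfl⟩ := this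
  simpa using hs

end SkewTheta

namespace IsTauDeltaIdeal

variable {R : Type*} [Ring R] {τ : R ≃+* R} {δ : R →+ R} {I : Ideal R}

theorem tau_mem (hI : IsTauDeltaIdeal τ δ I) {r : R} (hr : r ∈ I) : τ r ∈ I := by
  have : τ r ∈ τ '' (I : Set R) := ⟨r, hr, rfl⟩
  rwa [hI.map_tau] at this

theorem theta_mem (hI : IsTauDeltaIdeal τ δ I) (m k : ℕ) {r : R} (hr : r ∈ I) :
    skewTheta τ δ m k r ∈ I :=
  skewTheta_mem_ideal (fun _ => hI.tau_mem) hI.delta_mem m k r hr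

theorem invTheta_mem (hI : IsTauDeltaIdeal τ δ I) (m k : ℕ) {r : R} (hr : r ∈ I) :
    skewTheta τ.symm (invDelta τ δ) m k r ∈ I :=
  skewTheta_mem_ideal (fun _ => RingEquiv.symm_mem_of_image_eq hI.map_tau)
    (fun _ hr => I.neg_mem (hI.delta_mem _ (RingEquiv.symm_mem_of_image_eq hI.map_tau hr))) m k r hr

end IsTauDeltaIdeal

/-! ### Degree bounds for the inverse maps, and closedness of ideals of `R` -/

namespace SkewSetup

variable {R : Type*} [Ring R] {i : Ideal R} [i.IsTwoSided] {τ : R ≃+* R} {δ : R →+ R}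

theorem tau_symm_pow (h : SkewSetup i τ δ) (a : ℕ) : ∀ r ∈ i ^ a, τ.symm r ∈ i ^ a := by
  induction a with
  | zero => intro r _; rw [Submodule.pow_zero, Ideal.one_eq_top]; trivial
  | succ a ih =>
    intro r hr
    rw [Ideal.IsTwoSided.pow_succ] at hr ⊢
    refine Submodule.smul_induction_on hr (fun x hx y hy => ?_) (fun x y hx hy => ?_)
    · rw [smul_eq_mul, map_mul]
      exact Ideal.mul_mem_mul (RingEquiv.symm_mem_of_image_eq h.map_tau hx) (ih y hy)
    · rw [map_add]; exact Ideal.add_mem _ hx hy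

theorem invTheta_mem (h : SkewSetup i τ δ) (m k : ℕ) (r : R) :
    skewTheta τ.symm (invDelta τ δ) m k r ∈ i ^ (m - k) :=
  skewTheta_mem_pow h.tau_symm_pow
    (fun a r hr => (Ideal.neg_mem_iff _).mpr (h.delta_pow a _ (h.tau_symm_pow a r hr))) m k r

variable (I : Ideal R)

/-- Every left ideal of `R` is closed in the `i`-adic topology. -/
theorem mem_of_approx (h : SkewSetup i τ δ) {y : R}
    (hy : ∀ n : ℕ, ∃ z ∈ I, y - z ∈ i ^ n) : y ∈ I := by
  obtain ⟨ι, _, x, hx, H⟩ := exists_generators_left I h.separated h.complete h.noeth_left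
  obtain ⟨r, rfl⟩ := H y hy
  exact I.sum_mem fun k _ => I.mul_mem_left _ (hx k)

/-- The partial sums lie in `I`, and `I` is closed. This is how infinite coefficient sums in `T` are
kept inside `I`. -/
theorem adicSum_mem (h : SkewSetup i τ δ) {u : ℕ → R} {c : ℕ}
    (hu : ∀ m, u m ∈ i ^ (m - c)) (hI : ∀ m, u m ∈ I) : adicSum i u ∈ I := by
  refine h.mem_of_approx I fun n =>
    ⟨∑ k ∈ Finset.range (n + c), u k, I.sum_mem fun k _ => hI k, ?_⟩
  rw [← neg_sub]
  exact (Ideal.neg_mem_iff _).mpr (h.adicSum_approx u c hu n _ le_rfl)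

end SkewSetup

/-! ### Explicit products in `T` -/

namespace SkewPowerSeries

open SkewSetup

variable {R : Type*} [Ring R] {i : Ideal R} [i.IsTwoSided] {τ : R ≃+* R} {δ : R →+ R}
  {h : SkewSetup i τ δ}

@[simp] theorem coeff_sub (f g : SkewPowerSeries h) (n : ℕ) :
    (f - g).coeff n = f.coeff n - g.coeff n := by
  rw [sub_eq_add_neg, coeff_add, coeff_neg, sub_eq_add_neg]

theorem coeff_sum {ι : Type*} (s : Finset ι) (f : ι → SkewPowerSeries h) (n : ℕ) :
    (∑ k ∈ s, f k).coeff n = ∑ k ∈ s, (f k).coeff n := by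
  classical
  induction s using Finset.induction_on with
  | empty => rfl
  | insert a s ha ih => rw [Finset.sum_insert ha, Finset.sum_insert ha, coeff_add, ih]

theorem coeff_C (r : R) (n : ℕ) : (C h r).coeff n = if n = 0 then r else 0 := rfl

theorem coeff_Y (n : ℕ) : (Y h).coeff n = if n = 1 then 1 else 0 := rfl

/-- A product with a series with finitely many coefficients is a finite sum. -/
theorem coeff_mul_of_finite {f g : SkewPowerSeries h} {n p : ℕ} (hf : ∀ m, p ≤ m → f.coeff m = 0) :
    (f * g).coeff n = ∑ m ∈ Finset.range p, f.coeff m * (leftY τ δ)^[m] g.coeff n := by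
  refine coeff_mul_eq fun N => ⟨max (N + n) p, le_max_left _ _, ?_⟩
  rw [← Finset.sum_subset (Finset.range_mono (le_max_right (N + n) p)), sub_self]
  · exact Ideal.zero_mem _
  · intro m _ hm
    rw [hf m (by simpa using hm), zero_mul]

@[simp] theorem coeff_C_mul (r : R) (f : SkewPowerSeries h) (n : ℕ) :
    (C h r * f).coeff n = r * f.coeff n := by
  rw [coeff_mul_of_finite (p := 1) fun m hm => by
    rw [coeff_C, if_neg (Nat.one_le_iff_ne_zero.mp hm)]]
  simp [coeff_C]

theorem coeff_Y_mul (f : SkewPowerSeries h) : (Y h * f).coeff = leftY τ δ f.coeff := by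
  funext n
  rw [coeff_mul_of_finite (p := 2) fun m hm => by rw [coeff_Y, if_neg (by omega)]]
  simp [coeff_Y]

theorem coeff_Y_pow_mul (m : ℕ) (f : SkewPowerSeries h) :
    (Y h ^ m * f).coeff = (leftY τ δ)^[m] f.coeff := by
  induction m with
  | zero => simp
  | succ m ih => rw [pow_succ', mul_assoc, coeff_Y_mul, ih, Function.iterate_succ_apply']

theorem coeff_Y_pow (m n : ℕ) : (Y h ^ m).coeff n = if n = m then 1 else 0 := by
  rw [← mul_one (Y h ^ m), coeff_Y_pow_mul]
  exact iter_one h m n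

theorem coeff_Y_pow_mul_C (m n : ℕ) (r : R) :
    (Y h ^ m * C h r).coeff n = skewTheta τ δ m n r := by
  rw [coeff_Y_pow_mul, leftY_iter, Finset.sum_eq_single 0]
  · simp [coeff_C]
  · intro j _ hj
    rw [coeff_C, if_neg hj, map_zero]
  · simp

theorem leftY_iter_Y_pow (m p n : ℕ) :
    (leftY τ δ)^[m] (Y h ^ p).coeff n = if n = m + p then 1 else 0 := by
  rw [← coeff_Y_pow_mul, ← pow_add, coeff_Y_pow]

theorem coeff_mul_Y_pow (f : SkewPowerSeries h) (p n : ℕ) :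
    (f * Y h ^ p).coeff n = if p ≤ n then f.coeff (n - p) else 0 := by
  -- The extra `1` ensures that the only surviving index, `n - p`, lies in the range even for `N =
  -- 0` and `p = 0`.
  refine coeff_mul_eq fun N => ⟨N + n + 1, by omega, ?_⟩
  simp only [leftY_iter_Y_pow, mul_ite, mul_one, mul_zero]
  split_ifs with hp
  · rw [Finset.sum_eq_single (n - p), if_pos (by omega), sub_self]
    · exact Ideal.zero_mem _
    · intro m _ hm
      exact if_neg (by omega)
    · intro hm
      simp at hm
      omega
  · rw [Finset.sum_eq_zero, sub_zero]
    · exact Ideal.zero_mem _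
    · intro m _
      exact if_neg (by omega)

@[simp] theorem C_zero : C h 0 = 0 := by
  ext n
  simp [coeff_C]

theorem C_add (a b : R) : C h (a + b) = C h a + C h b := by
  ext n
  simp only [coeff_add, coeff_C]
  split_ifs <;> simp

theorem C_mul (a b : R) : C h (a * b) = C h a * C h b := by
  ext n
  simp only [coeff_C_mul, coeff_C, mul_ite, mul_zero]

variable (h) in
/-- The inclusion `R ⊆ T` as a ring homomorphism. -/
def CHom : R →+* SkewPowerSeries h where
  toFun := C h
  map_zero' := C_zero
  map_one' := rfl
  map_add' := C_add
  map_mul' := C_mul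

theorem C_sum {ι : Type*} (s : Finset ι) (r : ι → R) : C h (∑ k ∈ s, r k) = ∑ k ∈ s, C h (r k) :=
  map_sum (CHom h) r s

theorem C_sub (a b : R) : C h (a - b) = C h a - C h b := map_sub (CHom h) a b

/-! ### The `j`-adic filtration of `T` -/

theorem Y_mem_jIdeal : Y h ∈ jIdeal h :=
  TwoSidedIdeal.subset_span (Or.inr rfl)

theorem C_mem_jIdeal {r : R} (hr : r ∈ i) : C h r ∈ jIdeal h :=
  TwoSidedIdeal.subset_span (Or.inl ⟨r, hr, rfl⟩)

theorem Y_pow_mem_jIdeal_pow (n : ℕ) : Y h ^ n ∈ jIdeal h ^ n :=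
  Ideal.pow_mem_pow Y_mem_jIdeal n

theorem C_mem_jIdeal_pow (n : ℕ) : ∀ r ∈ i ^ n, C h r ∈ jIdeal h ^ n := by
  induction n with
  | zero => intro r _; simp [Submodule.pow_zero]
  | succ n ih =>
    intro r hr
    rw [Ideal.IsTwoSided.pow_succ] at hr ⊢
    refine Submodule.smul_induction_on hr (fun x hx y hy => ?_) (fun x y hx hy => ?_)
    · rw [smul_eq_mul, C_mul]
      exact Ideal.mul_mem_mul (C_mem_jIdeal hx) (ih y hy)
    · rw [C_add]
      exact Ideal.add_mem _ hx hy

/-- The term `f_m θ_{m,n-j}(g_j)` has degree at least `(a - m) + (b - j) + (m - (n - j))`, which is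
at least `a + b - n`. Thus giving `y` degree one yields a multiplicative filtration of `T`. -/
theorem coeff_mul_mem_pow {f g : SkewPowerSeries h} {a b : ℕ}
    (hf : ∀ k, f.coeff k ∈ i ^ (a - k)) (hg : ∀ k, g.coeff k ∈ i ^ (b - k)) (n : ℕ) :
    (f * g).coeff n ∈ i ^ (a + b - n) := by
  have hθ : ∀ c m k r, r ∈ i ^ c → skewTheta τ δ m k r ∈ i ^ (c + (m - k)) := by
    intro c m
    induction m with
    | zero =>
      intro k r hr
      rcases k with _ | k
      · rwa [Nat.sub_self, Nat.add_zero]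
      · exact Ideal.zero_mem _
    | succ m ih =>
      intro k r hr
      rcases k with _ | k
      · exact h.delta_pow _ _ (ih 0 r hr)
      · have e : m + 1 - (k + 1) = m - k := by omega
        rw [e]
        exact Ideal.add_mem _ (h.tau_pow _ _ (ih k r hr))
          (Ideal.pow_le_pow_right (by omega) (h.delta_pow _ _ (ih (k + 1) r hr)))
  rw [← sub_sub_self (∑ m ∈ Finset.range (a + b - n + n), f.coeff m * (leftY τ δ)^[m] g.coeff n)
    ((f * g).coeff n)]
  refine Ideal.sub_mem _ (Ideal.sum_mem _ fun m _ => ?_) (mul_approx f g _ n _ le_rfl)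
  rw [leftY_iter, Finset.mul_sum]
  refine Ideal.sum_mem _ fun j hj => ?_
  have hj' := Finset.mem_range.mp hj
  have := Ideal.mul_mem_mul (hf m) (hθ _ m (n - j) _ (hg j))
  rw [← Ideal.IsTwoSided.pow_add] at this
  exact Ideal.pow_le_pow_right (by omega) this

/-- The powers of `j`: `f ∈ j ^ n` if and only if the `k`-th coefficient is in `i ^ (n - k)`. -/
theorem mem_jIdeal_pow_iff (n : ℕ) (f : SkewPowerSeries h) :
    f ∈ jIdeal h ^ n ↔ ∀ k, f.coeff k ∈ i ^ (n - k) := by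
  constructor
  · intro hf
    induction n generalizing f with
    | zero => intro k; simp [Submodule.pow_zero]
    | succ n ih =>
      -- The first step of the coefficientwise filtration: a two-sided ideal containing `i` and `y`,
      -- hence all of `j`. Closure under multiplication is the case where one factor has degree `0`,
      -- which is no condition.
      let F : Ideal (SkewPowerSeries h) :=
        { carrier := {f | ∀ k, f.coeff k ∈ i ^ (1 - k)}
          zero_mem' := fun k => Ideal.zero_mem _
          add_mem' := fun hf hg k => Ideal.add_mem _ (hf k) (hg k)
          smul_mem' := fun c f hf k => by
            have := coeff_mul_mem_pow (f := c) (a := 0) (fun k => by simp [Submodule.pow_zero]) hf k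
            simpa using this }
      have hF : F.IsTwoSided := ⟨fun {f} c hf k => by
        have := coeff_mul_mem_pow (g := c) (b := 0) hf (fun k => by simp [Submodule.pow_zero]) k
        simpa using this⟩
      have hj : ∀ f ∈ jIdeal h, ∀ k, f.coeff k ∈ i ^ (1 - k) := by
        have h1 : TwoSidedIdeal.span (C h '' (i : Set R) ∪ {Y h}) ≤ F.toTwoSided := by
          rw [TwoSidedIdeal.span_le]
          rintro _ (⟨r, hr, rfl⟩ | rfl)
          · refine Ideal.mem_toTwoSided.mpr fun k => ?_
            rw [coeff_C]
            split_ifs with hk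
            · simpa [hk, Submodule.pow_one] using hr
            · exact Ideal.zero_mem _
          · refine Ideal.mem_toTwoSided.mpr fun k => ?_
            rw [coeff_Y]
            split_ifs with hk
            · simp [hk, Submodule.pow_zero]
            · exact Ideal.zero_mem _
        exact fun f hf => Ideal.mem_toTwoSided.mp (h1 hf)
      rw [Ideal.IsTwoSided.pow_succ] at hf
      refine Submodule.smul_induction_on hf (fun x hx y hy k => ?_) (fun x y hx hy k => ?_)
      · have := coeff_mul_mem_pow (hj x hx) (ih y hy) k
        rwa [Nat.add_comm 1 n] at this
      · exact Ideal.add_mem _ (hx k) (hy k)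
  · intro hf
    -- The tail is a left multiple of `y ^ n`, and each earlier term is a product of an element of
    -- `i ^ (n - k)` with `y ^ k`.
    have e : f = ∑ k ∈ Finset.range n, C h (f.coeff k) * Y h ^ k +
        (⟨fun k => f.coeff (k + n)⟩ : SkewPowerSeries h) * Y h ^ n := by
      ext m
      rw [coeff_add, coeff_sum, coeff_mul_Y_pow]
      simp only [coeff_C_mul, coeff_Y_pow, mul_ite, mul_one, mul_zero, Finset.sum_ite_eq,
        Finset.mem_range]
      rcases lt_or_ge m n with hm | hm
      · rw [if_pos hm, if_neg (by omega), add_zero]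
      · rw [if_neg (by omega), if_pos hm, zero_add, Nat.sub_add_cancel hm]
    rw [e]
    refine Ideal.add_mem _ (Ideal.sum_mem _ fun k hk => ?_)
      (Ideal.mul_mem_left _ _ (Y_pow_mem_jIdeal_pow n))
    have := Ideal.mul_mem_mul (C_mem_jIdeal_pow (n - k) _ (hf k)) (Y_pow_mem_jIdeal_pow (h := h) k)
    rwa [← Ideal.IsTwoSided.pow_add, Nat.sub_add_cancel (Finset.mem_range.mp hk).le] at this

end SkewPowerSeries

/-! ### Separation of `T` and truncation of series -/

namespace SkewPowerSeries

open SkewSetup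

variable {R : Type*} [Ring R] {i : Ideal R} [i.IsTwoSided] {τ : R ≃+* R} {δ : R →+ R}
  {h : SkewSetup i τ δ}

theorem eq_of_sub_mem_jIdeal_pow {f g : SkewPowerSeries h}
    (hfg : ∀ N, f - g ∈ jIdeal h ^ N) : f = g := by
  ext k
  refine h.eq_of_mod fun N => ?_
  have := (mem_jIdeal_pow_iff _ _).mp (hfg (N + k)) k
  rwa [coeff_sub, Nat.add_sub_cancel] at this

theorem coeff_sum_C_mul_Y_pow (f : ℕ → R) (p n : ℕ) :
    (∑ k ∈ Finset.range p, C h (f k) * Y h ^ k).coeff n = if n < p then f n else 0 := by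
  simp [coeff_sum, coeff_Y_pow]

theorem sum_C_mul_Y_pow_sub_mem (f : SkewPowerSeries h) (p : ℕ) :
    ∑ k ∈ Finset.range p, C h (f.coeff k) * Y h ^ k - f ∈ jIdeal h ^ p := by
  rw [mem_jIdeal_pow_iff]
  intro k
  rw [coeff_sub, coeff_sum_C_mul_Y_pow]
  split_ifs with hk
  · rw [sub_self]
    exact Ideal.zero_mem _
  · rw [Nat.sub_eq_zero_of_le (not_lt.mp hk), Submodule.pow_zero, Ideal.one_eq_top]
    trivial

theorem eq_sum_C_mul_Y_pow {f : SkewPowerSeries h} {p : ℕ} (hp : ∀ n, p ≤ n → f.coeff n = 0) :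
    f = ∑ k ∈ Finset.range p, C h (f.coeff k) * Y h ^ k := by
  ext n
  rw [coeff_sum_C_mul_Y_pow]
  split_ifs with hn
  · rfl
  · exact hp n (not_lt.mp hn)

/-! ### Series with coefficients on the right -/

/-- This is `y s = τ(s) y + δ(s)` at `s = τ⁻¹(r)`, solved for `r y`. -/
theorem C_mul_Y (r : R) : C h r * Y h = Y h * C h (τ.symm r) + C h (invDelta τ δ r) := by
  ext n
  have e := coeff_mul_Y_pow (C h r) 1 n
  rw [pow_one] at e
  rw [e, coeff_add, coeff_Y_mul]
  rcases n with _ | _ | n <;> simp [coeff_C, leftY, invDelta_apply]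

theorem C_mul_Y_pow (r : R) (m : ℕ) :
    C h r * Y h ^ m = ∑ k ∈ Finset.range (m + 1),
      Y h ^ k * C h (skewTheta τ.symm (invDelta τ δ) m k r) := by
  induction m with
  | zero => simp [skewTheta]
  | succ m ih =>
    set t := skewTheta τ.symm (invDelta τ δ) with ht
    -- Shifting the index adds a term at `k = m + 1`, which vanishes because `t m (m + 1) = 0`; the
    -- sums then match the recursion for `t`.
    have e1 : ∑ k ∈ Finset.range (m + 1), Y h ^ k * C h (invDelta τ δ (t m k r)) =
        ∑ k ∈ Finset.range (m + 1), Y h ^ (k + 1) * C h (invDelta τ δ (t m (k + 1) r)) +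
          C h (invDelta τ δ (t m 0 r)) := by
      have := Finset.sum_range_succ (fun k => Y h ^ k * C h (invDelta τ δ (t m k r))) (m + 1)
      rw [Finset.sum_range_succ' _ (m + 1), ht, theta_eq_zero _ _ m (m + 1) m.lt_succ_self] at this
      simpa using this.symm
    have e2 : ∀ k, t (m + 1) (k + 1) r = τ.symm (t m k r) + invDelta τ δ (t m (k + 1) r) :=
      fun _ => rfl
    have e3 : t (m + 1) 0 r = invDelta τ δ (t m 0 r) := rfl
    rw [pow_succ, ← mul_assoc, ih, Finset.sum_mul, Finset.sum_range_succ' _ (m + 1)]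
    simp only [mul_assoc, C_mul_Y, mul_add, Finset.sum_add_distrib, e1, e2, e3, C_add,
      pow_succ, pow_zero, one_mul]
    abel

variable (h) in
/-- The series `∑ y ^ n b_n`, with coefficients collected on the left. -/
noncomputable def rightSum (b : ℕ → R) : SkewPowerSeries h :=
  ⟨fun k => adicSum i fun m => skewTheta τ δ m k (b m)⟩

/-- The contribution of `y ^ n b_n` to coefficient `k` lies in `i ^ (n - k)` for any `b_n`, so
convergence is automatic and the error after `M` terms is in `i ^ (M - k)`. -/
theorem sum_sub_rightSum_mem (b : ℕ → R) (M : ℕ) :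
    ∑ n ∈ Finset.range M, Y h ^ n * C h (b n) - rightSum h b ∈ jIdeal h ^ M := by
  rw [mem_jIdeal_pow_iff]
  intro k
  rw [coeff_sub, coeff_sum]
  simp only [coeff_Y_pow_mul_C]
  rcases le_total k M with hk | hk
  · exact h.adicSum_approx _ k (fun m => h.theta_mem m k (b m)) (M - k) M (by omega)
  · rw [Nat.sub_eq_zero_of_le hk, Submodule.pow_zero, Ideal.one_eq_top]
    trivial

theorem isRightSeries_of_sub_mem {b : ℕ → R} {f : SkewPowerSeries h}
    (H : ∀ M, ∑ n ∈ Finset.range M, Y h ^ n * C h (b n) - f ∈ jIdeal h ^ M) :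
    IsRightSeries h b f :=
  (adicTendsto_iff _ _ _).mpr fun N => ⟨N, fun M hM => Ideal.pow_le_pow_right hM (H M)⟩

theorem isRightSeries_rightSum (b : ℕ → R) : IsRightSeries h b (rightSum h b) :=
  isRightSeries_of_sub_mem (sum_sub_rightSum_mem b)

/-- The coefficients `b_n` of a series `f` written in the form `∑ y ^ n b_n`. -/
noncomputable def rightCoeff (f : SkewPowerSeries h) (k : ℕ) : R :=
  adicSum i fun m => skewTheta τ.symm (invDelta τ δ) m k (f.coeff m)

/-- Truncate `f` at `M` and move all powers of `y` to the left. The finite sums so obtained differ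
from the `rightCoeff f k` by elements of `i ^ (M - k)`, and multiplication by `y ^ k` puts this
error into the `M`-th power of `j`. -/
theorem sum_rightCoeff_sub_mem (f : SkewPowerSeries h) (M : ℕ) :
    ∑ k ∈ Finset.range M, Y h ^ k * C h (rightCoeff f k) - f ∈ jIdeal h ^ M := by
  set t := skewTheta τ.symm (invDelta τ δ) with ht
  have e : ∑ m ∈ Finset.range M, C h (f.coeff m) * Y h ^ m =
      ∑ k ∈ Finset.range M, Y h ^ k * C h (∑ m ∈ Finset.range M, t m k (f.coeff m)) := by
    simp only [C_sum, Finset.mul_sum]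
    rw [Finset.sum_comm]
    refine Finset.sum_congr rfl fun m hm => ?_
    rw [C_mul_Y_pow]
    refine Finset.sum_subset (Finset.range_mono (Finset.mem_range.mp hm)) fun k _ hk => ?_
    rw [theta_eq_zero _ _ m k (by simpa using hk)]
    simp
  have h1 := sum_C_mul_Y_pow_sub_mem f M
  rw [e] at h1
  rw [← sub_add_sub_cancel]
  refine Ideal.add_mem _ ?_ h1
  rw [← Finset.sum_sub_distrib]
  refine Ideal.sum_mem _ fun k hk => ?_
  have hk := Finset.mem_range.mp hk
  rw [← mul_sub, ← C_sub, ← neg_sub]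
  have h2 := h.adicSum_approx (fun m => t m k (f.coeff m)) k
    (fun m => h.invTheta_mem m k _) (M - k) M (by omega)
  have := Ideal.mul_mem_mul (Y_pow_mem_jIdeal_pow (h := h) k)
    (C_mem_jIdeal_pow (h := h) (M - k) _ ((Ideal.neg_mem_iff _).mpr h2))
  rwa [← Ideal.IsTwoSided.pow_add, Nat.add_sub_cancel' hk.le] at this

theorem rightSum_rightCoeff (f : SkewPowerSeries h) : rightSum h (rightCoeff f) = f :=
  eq_of_sub_mem_jIdeal_pow fun N => by
    have := Ideal.sub_mem _ (sum_rightCoeff_sub_mem f N) (sum_sub_rightSum_mem (rightCoeff f) N)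
    simpa using this

/-- Right multiplication by constants acts termwise on right expansions; this regroups a series
according to finitely many left ideal generators. -/
theorem rightSum_mul_C_sum {ι : Type*} [Fintype ι] (r : ι → ℕ → R) (x : ι → R) :
    rightSum h (fun n => ∑ k, r k n * x k) = ∑ k, rightSum h (r k) * C h (x k) :=
  eq_of_sub_mem_jIdeal_pow fun N => by
    have h1 := sum_sub_rightSum_mem (h := h) (fun n => ∑ k, r k n * x k) N
    have h2 : ∑ k, (∑ n ∈ Finset.range N, Y h ^ n * C h (r k n) - rightSum h (r k)) * C h (x k) ∈
        jIdeal h ^ N :=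
      Ideal.sum_mem _ fun k _ => Ideal.mul_mem_right _ _ (sum_sub_rightSum_mem _ N)
    have e : ∑ n ∈ Finset.range N, Y h ^ n * C h (∑ k, r k n * x k) =
        ∑ k, (∑ n ∈ Finset.range N, Y h ^ n * C h (r k n)) * C h (x k) := by
      simp only [C_sum, C_mul, Finset.mul_sum, Finset.sum_mul, mul_assoc]
      rw [Finset.sum_comm]
    rw [e] at h1
    have := Ideal.sub_mem _ h2 h1
    simpa [sub_mul, Finset.sum_sub_distrib] using this

variable {I : Ideal R}

theorem rightCoeff_mem (hI : IsTauDeltaIdeal τ δ I) {f : SkewPowerSeries h}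
    (hf : f ∈ leftSeries h I) (k : ℕ) : rightCoeff f k ∈ I :=
  h.adicSum_mem I (fun m => h.invTheta_mem m k _) fun m => hI.invTheta_mem m k (hf m)

/-- Approximation in `T` forces approximation of each coefficient, and `I` is closed in `R`. -/
theorem mem_leftSeries_of_approx {f : SkewPowerSeries h}
    (H : ∀ N, ∃ g ∈ leftSeries h I, g - f ∈ jIdeal h ^ N) : f ∈ leftSeries h I := fun k => by
  refine h.mem_of_approx I fun N => ?_
  obtain ⟨g, hg, hgf⟩ := H (N + k)
  refine ⟨g.coeff k, hg k, ?_⟩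
  have := (mem_jIdeal_pow_iff _ _).mp hgf k
  rw [coeff_sub, Nat.add_sub_cancel] at this
  rw [← neg_sub]
  exact (Ideal.neg_mem_iff _).mpr this

/-! ### The ideal `I[[y; τ, δ]]` -/

variable (h) in
/-- `I[[y; τ, δ]]` as an ideal of `T`. -/
def seriesIdeal (hI : IsTauDeltaIdeal τ δ I) : Ideal (SkewPowerSeries h) where
  carrier := leftSeries h I
  zero_mem' _ := I.zero_mem
  add_mem' hf hg n := I.add_mem (hf n) (hg n)
  smul_mem' g f hf n := by
    rw [smul_eq_mul, coeff_mul]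
    exact I.sum_mem fun j _ => h.adicSum_mem I
      (fun m => Ideal.mul_mem_left _ _ (h.theta_mem m (n - j) _))
      fun m => I.mul_mem_left _ (hI.theta_mem m (n - j) (hf j))

instance [I.IsTwoSided] (hI : IsTauDeltaIdeal τ δ I) : (seriesIdeal h hI).IsTwoSided where
  mul_mem_of_left {f} g hf n := by
    have hf : ∀ n, f.coeff n ∈ I := hf
    rw [coeff_mul]
    exact I.sum_mem fun j _ => h.adicSum_mem I
      (fun m => Ideal.mul_mem_left _ _ (h.theta_mem m (n - j) _))
      fun m => I.mul_mem_right _ (hf m)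

theorem mem_seriesIdeal {hI : IsTauDeltaIdeal τ δ I} {f : SkewPowerSeries h} :
    f ∈ seriesIdeal h hI ↔ ∀ n, f.coeff n ∈ I := Iff.rfl

theorem C_mem_seriesIdeal (hI : IsTauDeltaIdeal τ δ I) {a : R} (ha : a ∈ I) :
    C h a ∈ seriesIdeal h hI := fun n => by
  rw [coeff_C]
  split_ifs
  · exact ha
  · exact I.zero_mem

theorem leftSeries_eq_rightSeries (hI : IsTauDeltaIdeal τ δ I) :
    leftSeries h I = rightSeries h I := by
  ext f
  refine ⟨fun hf => ⟨rightCoeff f, rightCoeff_mem hI hf,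
    isRightSeries_of_sub_mem (sum_rightCoeff_sub_mem f)⟩, ?_⟩
  rintro ⟨b, hb, hbf⟩
  refine mem_leftSeries_of_approx fun N => ?_
  obtain ⟨M, hM⟩ := (adicTendsto_iff _ _ _).mp hbf N
  exact ⟨_, (seriesIdeal h hI).sum_mem fun n _ =>
    Ideal.mul_mem_left _ _ (C_mem_seriesIdeal hI (hb n)), hM M le_rfl⟩

/-! ### The products `IS`, `SI`, `IT` and `TI` -/

theorem C_mem_polySubring (r : R) : C h r ∈ polySubring h :=
  ⟨1, fun n hn => by rw [coeff_C, if_neg (Nat.one_le_iff_ne_zero.mp hn)]⟩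

theorem Y_mem_polySubring : Y h ∈ polySubring h :=
  ⟨2, fun n hn => by rw [coeff_Y, if_neg (by omega)]⟩

/-- `IS = SI` is obtained by giving both products the same description. A polynomial is the finite
sum of its terms `a_k y ^ k`; for `SI` these terms are rewritten with `y` on the left. -/
theorem coe_sumsOfProducts_C_polySubring [I.IsTwoSided] (hI : IsTauDeltaIdeal τ δ I) :
    (sumsOfProducts (C h '' (I : Set R)) (polySubring h : Set (SkewPowerSeries h)) :
      Set (SkewPowerSeries h)) = leftSeries h I ∩ polySubring h := by
  refine Set.Subset.antisymm ?_ ?_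
  · change sumsOfProducts _ _ ≤
      (seriesIdeal h hI).toAddSubgroup ⊓ (polySubring h).toAddSubgroup
    refine (AddSubgroup.closure_le _).mpr ?_
    rintro _ ⟨_, ⟨a, ha, rfl⟩, g, hg, rfl⟩
    exact ⟨Ideal.mul_mem_right _ (seriesIdeal h hI) (C_mem_seriesIdeal hI ha),
      (polySubring h).mul_mem (C_mem_polySubring a) hg⟩
  · rintro f ⟨hf, p, hp⟩
    rw [eq_sum_C_mul_Y_pow hp]
    exact AddSubgroup.sum_mem _ fun k _ => AddSubgroup.subset_closure
      ⟨_, ⟨_, hf k, rfl⟩, _, (polySubring h).pow_mem Y_mem_polySubring k, rfl⟩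

theorem coe_sumsOfProducts_polySubring_C (hI : IsTauDeltaIdeal τ δ I) :
    (sumsOfProducts (polySubring h : Set (SkewPowerSeries h)) (C h '' (I : Set R)) :
      Set (SkewPowerSeries h)) = leftSeries h I ∩ polySubring h := by
  refine Set.Subset.antisymm ?_ ?_
  · change sumsOfProducts _ _ ≤
      (seriesIdeal h hI).toAddSubgroup ⊓ (polySubring h).toAddSubgroup
    refine (AddSubgroup.closure_le _).mpr ?_
    rintro _ ⟨g, hg, _, ⟨a, ha, rfl⟩, rfl⟩
    exact ⟨Ideal.mul_mem_left (seriesIdeal h hI) _ (C_mem_seriesIdeal hI ha),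
      (polySubring h).mul_mem hg (C_mem_polySubring a)⟩
  · rintro f ⟨hf, p, hp⟩
    rw [eq_sum_C_mul_Y_pow hp]
    refine AddSubgroup.sum_mem _ fun k _ => ?_
    rw [C_mul_Y_pow]
    exact AddSubgroup.sum_mem _ fun l _ => AddSubgroup.subset_closure
      ⟨_, (polySubring h).pow_mem Y_mem_polySubring l, _,
        ⟨_, hI.invTheta_mem k l (hf k), rfl⟩, rfl⟩

/-- Truncations of a series over `I` are polynomials over `I` converging to it; conversely the set
of series over `I` is closed. -/
theorem leftSeries_eq_closure [I.IsTwoSided] (hI : IsTauDeltaIdeal τ δ I) :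
    leftSeries h I = @closure _ (adicTopology (jIdeal h))
      (leftSeries h I ∩ polySubring h) := by
  let _ := adicTopology (jIdeal h)
  ext f
  rw [mem_closure_iff_nhds_basis ((adicBasis (jIdeal h)).hasBasis_nhds f)]
  constructor
  · intro hf N _
    refine ⟨∑ k ∈ Finset.range N, C h (f.coeff k) * Y h ^ k, ⟨?_, ?_⟩,
      sum_C_mul_Y_pow_sub_mem f N⟩
    · exact (seriesIdeal h hI).sum_mem fun k _ =>
        Ideal.mul_mem_right _ _ (C_mem_seriesIdeal hI (hf k))
    · exact (polySubring h).sum_mem fun k _ =>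
        (polySubring h).mul_mem (C_mem_polySubring _)
          ((polySubring h).pow_mem Y_mem_polySubring k)
  · intro H
    refine mem_leftSeries_of_approx fun N => ?_
    obtain ⟨g, hg, hgf⟩ := H N trivial
    exact ⟨g, hg.1, hgf⟩

theorem coe_sumsOfProducts_C_univ [I.IsTwoSided] (hI : IsTauDeltaIdeal τ δ I) :
    (sumsOfProducts (C h '' (I : Set R)) Set.univ : Set (SkewPowerSeries h)) =
      leftSeries h I := by
  refine Set.Subset.antisymm ?_ fun f hf => ?_
  · change sumsOfProducts _ _ ≤ (seriesIdeal h hI).toAddSubgroup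
    refine (AddSubgroup.closure_le _).mpr ?_
    rintro _ ⟨_, ⟨a, ha, rfl⟩, g, _, rfl⟩
    exact Ideal.mul_mem_right _ (seriesIdeal h hI) (C_mem_seriesIdeal hI ha)
  -- One finite family `x` serves all coefficients `f_n = ∑ x_k r_{n,k}`, so `f` is the finite sum
  -- of the products of `x_k` with `∑ r_{n,k} y ^ n`.
  · obtain ⟨ι, _, x, hx, H⟩ := exists_generators_right I h.separated h.complete h.noeth_right
    choose r hr using fun n => H (f.coeff n) fun N => ⟨_, hf n, by simp⟩
    have e : f = ∑ k, C h (x k) * (⟨fun n => r n k⟩ : SkewPowerSeries h) := by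
      ext n
      rw [coeff_sum, hr n]
      simp only [coeff_C_mul]
    rw [e]
    exact AddSubgroup.sum_mem _ fun k _ => AddSubgroup.subset_closure
      ⟨_, ⟨_, hx k, rfl⟩, _, trivial, rfl⟩

theorem coe_sumsOfProducts_univ_C (hI : IsTauDeltaIdeal τ δ I) :
    (sumsOfProducts Set.univ (C h '' (I : Set R)) : Set (SkewPowerSeries h)) =
      leftSeries h I := by
  refine Set.Subset.antisymm ?_ fun f hf => ?_
  · change sumsOfProducts _ _ ≤ (seriesIdeal h hI).toAddSubgroup
    refine (AddSubgroup.closure_le _).mpr ?_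
    rintro _ ⟨g, _, _, ⟨a, ha, rfl⟩, rfl⟩
    exact Ideal.mul_mem_left (seriesIdeal h hI) _ (C_mem_seriesIdeal hI ha)
  · obtain ⟨ι, _, x, hx, H⟩ := exists_generators_left I h.separated h.complete h.noeth_left
    -- Right coefficients are needed here, since the generators must end up to the right of the
    -- powers of `y`.
    choose r hr using fun n => H (rightCoeff f n) fun N => ⟨_, rightCoeff_mem hI hf n, by simp⟩
    have e : f = ∑ k, rightSum h (fun n => r n k) * C h (x k) := by
      rw [← rightSum_mul_C_sum, ← funext hr]
      exact (rightSum_rightCoeff f).symm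
    rw [e]
    exact AddSubgroup.sum_mem _ fun k _ => AddSubgroup.subset_closure
      ⟨_, trivial, _, ⟨_, hx k, rfl⟩, rfl⟩

end SkewPowerSeries

/-! ### Images of adic filtrations under surjections -/

section Quotient

variable {A B : Type*} [Ring A] [Ring B] (π : A →+* B) [RingHomSurjective π]
  (J : Ideal A) [J.IsTwoSided]

/-- By surjectivity the image of `J` is already an ideal, so products of its elements lift factor by
factor. This allows filtration degrees to be lifted along `π`. -/
theorem mem_map_pow_iff (n : ℕ) {x : B} : x ∈ J.map π ^ n ↔ ∃ y ∈ J ^ n, π y = x := by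
  constructor
  · induction n generalizing x with
    | zero =>
      intro _
      obtain ⟨y, rfl⟩ := RingHomSurjective.is_surjective (σ := π) x
      exact ⟨y, by rw [Submodule.pow_zero, Ideal.one_eq_top]; trivial, rfl⟩
    | succ n ih =>
      intro hx
      rw [Ideal.IsTwoSided.pow_succ] at hx
      refine Submodule.smul_induction_on hx (fun x hx y hy => ?_) ?_
      · obtain ⟨a, ha, rfl⟩ :=
          (Ideal.mem_map_iff_of_surjective π RingHomSurjective.is_surjective).mp hx
        obtain ⟨b, hb, rfl⟩ := ih hy
        refine ⟨a * b, ?_, map_mul π a b⟩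
        rw [Ideal.IsTwoSided.pow_succ]
        exact Ideal.mul_mem_mul ha hb
      · rintro _ _ ⟨a, ha, rfl⟩ ⟨b, hb, rfl⟩
        exact ⟨a + b, Ideal.add_mem _ ha hb, map_add π a b⟩
  · rintro ⟨y, hy, rfl⟩
    induction n generalizing y with
    | zero => rw [Submodule.pow_zero, Ideal.one_eq_top]; trivial
    | succ n ih =>
      rw [Ideal.IsTwoSided.pow_succ] at hy ⊢
      refine Submodule.smul_induction_on hy (fun x hx y hy => ?_) (fun x y hx hy => ?_)
      · rw [smul_eq_mul, map_mul]
        exact Ideal.mul_mem_mul (Ideal.mem_map_of_mem π hx) (ih y hy)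
      · rw [map_add]
        exact Ideal.add_mem _ hx hy

/-- The map of Rees rings induced by a surjection. -/
noncomputable def reesMap : reesRing J →+* reesRing (J.map π) :=
  (Polynomial.mapRingHom π).restrict (reesRing J) (reesRing (J.map π)) fun f hf n => by
    rw [Polynomial.coe_mapRingHom, Polynomial.coeff_map]
    exact (mem_map_pow_iff π J n).mpr ⟨_, hf n, rfl⟩

theorem coeff_reesMap (f : reesRing J) (n : ℕ) :
    (reesMap π J f).1.coeff n = π (f.1.coeff n) :=
  Polynomial.coeff_map π n

theorem reesMap_surjective : Function.Surjective (reesMap π J) := by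
  intro g
  have hex : ∀ n, ∃ y ∈ J ^ n, π y = g.1.coeff n := fun n =>
    (mem_map_pow_iff π J n).mp (g.2 n)
  choose y hy hyg using hex
  have hcoeff : ∀ n, (∑ m ∈ g.1.support, Polynomial.monomial m (y m)).coeff n =
      if n ∈ g.1.support then y n else 0 := fun n => by
    simp only [Polynomial.finsetSum_coeff, Polynomial.coeff_monomial, Finset.sum_ite_eq']
  refine ⟨⟨∑ m ∈ g.1.support, Polynomial.monomial m (y m), fun n => ?_⟩,
    Subtype.ext (Polynomial.ext fun n => ?_)⟩
  · rw [hcoeff]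
    split_ifs
    · exact hy n
    · exact Ideal.zero_mem _
  · rw [coeff_reesMap, hcoeff]
    split_ifs with hn
    · exact hyg n
    · rw [map_zero, Polynomial.notMem_support_iff.mp hn]

/-- The map of associated graded rings induced by a surjection. -/
noncomputable def assocGradedMap : AssocGraded J →+* AssocGraded (J.map π) :=
  Ideal.quotientMap (reesShift (J.map π)) (reesMap π J) fun f hf n => by
    rw [coeff_reesMap]
    exact (mem_map_pow_iff π J (n + 1)).mpr ⟨_, hf n, rfl⟩

theorem assocGradedMap_surjective : Function.Surjective (assocGradedMap π J) := by
  intro y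
  obtain ⟨y, rfl⟩ := Ideal.Quotient.mk_surjective y
  obtain ⟨x, rfl⟩ := reesMap_surjective π J y
  exact ⟨Ideal.Quotient.mk _ x, rfl⟩

theorem isNoetherianRing_assocGraded_map [IsNoetherianRing (AssocGraded J)] :
    IsNoetherianRing (AssocGraded (J.map π)) :=
  isNoetherianRing_of_surjective _ _ _ (assocGradedMap_surjective π J)

theorem isNoetherianRing_assocGraded_map_op [IsNoetherianRing (AssocGraded J)ᵐᵒᵖ] :
    IsNoetherianRing (AssocGraded (J.map π))ᵐᵒᵖ :=
  isNoetherianRing_of_surjective _ _ (RingHom.op (assocGradedMap π J)) fun y => by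
    obtain ⟨x, hx⟩ := assocGradedMap_surjective π J y.unop
    exact ⟨MulOpposite.op x, MulOpposite.unop_injective hx⟩

end Quotient

/-! ### The standing assumptions for `R/I` -/

namespace SkewSetup

variable {R : Type*} [Ring R] {i : Ideal R} [i.IsTwoSided] {τ : R ≃+* R} {δ : R →+ R}
  {I : Ideal R} [I.IsTwoSided]

theorem quotient_separated (h : SkewSetup i τ δ) :
    AdicSeparated (i.map (Ideal.Quotient.mk I)) := by
  intro x hx
  obtain ⟨y, rfl⟩ := Ideal.Quotient.mk_surjective x
  refine Ideal.Quotient.eq_zero_iff_mem.mpr (h.mem_of_approx I fun n => ?_)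
  obtain ⟨z, hz, hzy⟩ := (mem_map_pow_iff _ i n).mp (hx n)
  exact ⟨y - z, Ideal.Quotient.eq.mp hzy.symm, by simpa using hz⟩

/-- Pass to a subsequence whose `n`-th increment lies in the image of `i ^ n`, lift the increments
to `i ^ n`, and sum them in the complete ring `R`. -/
theorem quotient_complete (h : SkewSetup i τ δ) :
    AdicComplete (i.map (Ideal.Quotient.mk I)) := by
  intro u hu
  choose N hN using hu
  -- A monotone majorant of the Cauchy moduli `N`.
  let M : ℕ → ℕ := fun n => ∑ l ∈ Finset.range (n + 1), N l
  have hNM : ∀ n, N n ≤ M n := fun n =>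
    Finset.single_le_sum (f := N) (fun _ _ => Nat.zero_le _) (Finset.self_mem_range_succ n)
  have hMs : ∀ n, M n ≤ M (n + 1) := fun n => by
    simp only [M, Finset.sum_range_succ _ (n + 1), Nat.le_add_right]
  choose d hd hdu using fun n => (mem_map_pow_iff (Ideal.Quotient.mk I) i n).mp
    (hN n (M (n + 1)) (M n) ((hNM n).trans (hMs n)) (hNM n))
  obtain ⟨w, hw⟩ := Ideal.Quotient.mk_surjective (u (M 0))
  have hsum : ∀ n, Ideal.Quotient.mk I (w + ∑ l ∈ Finset.range n, d l) = u (M n) := fun n => by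
    rw [map_add, map_sum, hw, Finset.sum_congr rfl fun l _ => hdu l,
      Finset.sum_range_sub fun l => u (M l)]
    abel
  refine ⟨Ideal.Quotient.mk I (w + adicSum i d), (adicTendsto_iff _ _ _).mpr fun n =>
    ⟨M n, fun m hm => ?_⟩⟩
  rw [← sub_add_sub_cancel _ (u (M n))]
  refine Ideal.add_mem _ (hN n m (M n) ((hNM n).trans hm) (hNM n)) ?_
  rw [← hsum n, ← map_sub, add_sub_add_left_eq_sub]
  exact (mem_map_pow_iff _ i n).mpr
    ⟨_, h.adicSum_approx d 0 (fun m => by simpa using hd m) n n le_rfl, rfl⟩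

/-- The standing assumptions pass to the quotient by a `τ`-`δ`-ideal. -/
theorem quotient (h : SkewSetup i τ δ) (hI : IsTauDeltaIdeal τ δ I) :
    SkewSetup (i.map (Ideal.Quotient.mk I)) hI.quotTau hI.quotDelta where
  separated := h.quotient_separated
  complete := h.quotient_complete
  noeth_left := haveI := h.noeth_left; isNoetherianRing_assocGraded_map _ i
  noeth_right := haveI := h.noeth_right; isNoetherianRing_assocGraded_map_op _ i
  leibniz a b := by
    obtain ⟨a, rfl⟩ := Ideal.Quotient.mk_surjective a
    obtain ⟨b, rfl⟩ := Ideal.Quotient.mk_surjective b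
    simp only [← map_mul, hI.quotDelta_mk, hI.quotTau_mk, h.leibniz, map_add]
  map_tau := by
    have hmem : ∀ x, x ∈ i.map (Ideal.Quotient.mk I) ↔ ∃ y ∈ i, Ideal.Quotient.mk I y = x :=
      fun x => Ideal.mem_map_iff_of_surjective _ Ideal.Quotient.mk_surjective
    ext x
    simp only [Set.mem_image, SetLike.mem_coe, hmem]
    constructor
    · rintro ⟨_, ⟨y, hy, rfl⟩, rfl⟩
      refine ⟨τ y, ?_, rfl⟩
      have : τ y ∈ τ '' (i : Set R) := ⟨y, hy, rfl⟩
      rwa [h.map_tau] at this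
    · rintro ⟨y, hy, rfl⟩
      refine ⟨_, ⟨τ.symm y, RingEquiv.symm_mem_of_image_eq h.map_tau hy, rfl⟩, ?_⟩
      rw [hI.quotTau_mk, RingEquiv.apply_symm_apply]
  delta_mem a := by
    obtain ⟨a, rfl⟩ := Ideal.Quotient.mk_surjective a
    exact Ideal.mem_map_of_mem _ (h.delta_mem a)
  delta_mem_sq a ha := by
    obtain ⟨y, hy, rfl⟩ :=
      (Ideal.mem_map_iff_of_surjective _ Ideal.Quotient.mk_surjective).mp ha
    exact (mem_map_pow_iff _ i 2).mpr ⟨_, h.delta_mem_sq y hy, rfl⟩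

end SkewSetup

/-! ### Reduction of coefficients modulo `I` -/

namespace SkewPowerSeries

open SkewSetup

variable {R : Type*} [Ring R] {i : Ideal R} [i.IsTwoSided] {τ : R ≃+* R} {δ : R →+ R}
  {I : Ideal R} [I.IsTwoSided]

theorem leftY_iter_mk (hI : IsTauDeltaIdeal τ δ I) (g : ℕ → R) (m n : ℕ) :
    (leftY hI.quotTau hI.quotDelta)^[m] (fun k => Ideal.Quotient.mk I (g k)) n =
      Ideal.Quotient.mk I ((leftY τ δ)^[m] g n) := by
  induction m generalizing n with
  | zero => rfl
  | succ m ih =>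
    rw [Function.iterate_succ_apply', Function.iterate_succ_apply', funext ih]
    rcases n with _ | n
    · rfl
    · rw [leftY, leftY, map_add]
      rfl

variable (h : SkewSetup i τ δ) (hI : IsTauDeltaIdeal τ δ I)

/-- Reduction of coefficients modulo `I`, as a ring homomorphism. -/
def reduction : SkewPowerSeries h →+* SkewPowerSeries (h.quotient hI) where
  toFun f := ⟨fun n => Ideal.Quotient.mk I (f.coeff n)⟩
  map_zero' := rfl
  map_one' := by
    ext n
    simp only [coeff_one]
    split_ifs <;> simp
  map_add' _ _ := rfl
  map_mul' f g := by
    ext n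
    -- A product coefficient over `R/I` is determined by its finite approximations, and these are
    -- the images of the approximations over `R`.
    refine (coeff_mul_eq fun N => ⟨N + n, le_rfl, ?_⟩).symm
    simp only [leftY_iter_mk, ← map_mul, ← map_sum, ← map_sub]
    exact (mem_map_pow_iff _ i N).mpr ⟨_, mul_approx f g N n _ le_rfl, rfl⟩

theorem reduction_surjective : Function.Surjective (reduction h hI) := by
  intro g
  choose f hf using fun n => Ideal.Quotient.mk_surjective (g.coeff n)
  exact ⟨⟨f⟩, SkewPowerSeries.ext (funext hf)⟩

theorem seriesIdeal_eq_ker : seriesIdeal h hI = RingHom.ker (reduction h hI) := by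
  ext f
  rw [RingHom.mem_ker, mem_seriesIdeal, SkewPowerSeries.ext_iff, funext_iff]
  exact forall_congr' fun n => Ideal.Quotient.eq_zero_iff_mem.symm

/-- The isomorphism `T/I[[y; τ, δ]] ≅ (R/I)[[y; τ, δ]]`. -/
noncomputable def quotientEquiv :
    (SkewPowerSeries h ⧸ seriesIdeal h hI) ≃+* SkewPowerSeries (h.quotient hI) :=
  (Ideal.quotEquivOfEq (seriesIdeal_eq_ker h hI)).trans
    (RingHom.quotientKerEquivOfSurjective (reduction_surjective h hI))

end SkewPowerSeries

theorem mainTheorem4 {R : Type*} [Ring R] [Nontrivial R] (i : Ideal R) [i.IsTwoSided]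
    (τ : R ≃+* R) (δ : R →+ R) (h : SkewSetup i τ δ)
    (I : Ideal R) [I.IsTwoSided] (hI : IsTauDeltaIdeal τ δ I) :
    -- every series `∑ y ^ n b_n` with coefficients in `I` on the right converges in `T`, and
    -- these series are exactly the series with coefficients in `I` on the left
    ((∀ b : ℕ → R, (∀ n, b n ∈ I) → ∃ f, SkewPowerSeries.IsRightSeries h b f) ∧
      SkewPowerSeries.leftSeries h I = SkewPowerSeries.rightSeries h I) ∧
    -- `IS = SI`
    sumsOfProducts (SkewPowerSeries.C h '' (I : Set R))
        (SkewPowerSeries.polySubring h : Set (SkewPowerSeries h)) =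
      sumsOfProducts (SkewPowerSeries.polySubring h : Set (SkewPowerSeries h))
        (SkewPowerSeries.C h '' (I : Set R)) ∧
    -- `I[[y; τ, δ]]` is the closure of `IS` in the `j`-adic topology of `T`
    SkewPowerSeries.leftSeries h I =
      @closure _ (adicTopology (SkewPowerSeries.jIdeal h))
        (sumsOfProducts (SkewPowerSeries.C h '' (I : Set R))
          (SkewPowerSeries.polySubring h : Set (SkewPowerSeries h)) : Set (SkewPowerSeries h)) ∧
    -- `IT = I[[y; τ, δ]] = TI`
    (sumsOfProducts (SkewPowerSeries.C h '' (I : Set R)) Set.univ : Set (SkewPowerSeries h)) =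
      SkewPowerSeries.leftSeries h I ∧
    SkewPowerSeries.leftSeries h I =
      (sumsOfProducts Set.univ (SkewPowerSeries.C h '' (I : Set R)) : Set (SkewPowerSeries h)) ∧
    -- `I[[y; τ, δ]] = IT` is a two-sided ideal `J` of `T`, the standing assumptions pass to `R/I`
    -- with the induced maps, and reduction of coefficients gives `T/J ≅ (R/I)[[y; τ, δ]]`
    ∃ (J : Ideal (SkewPowerSeries h)) (_ : J.IsTwoSided)
      (hq : SkewSetup (i.map (Ideal.Quotient.mk I)) hI.quotTau hI.quotDelta)
      (e : (SkewPowerSeries h ⧸ J) ≃+* SkewPowerSeries hq),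
      (J : Set (SkewPowerSeries h)) = SkewPowerSeries.leftSeries h I ∧
      ∀ (f : SkewPowerSeries h) (n : ℕ),
        (e (Ideal.Quotient.mk J f)).coeff n = Ideal.Quotient.mk I (f.coeff n) := by
  refine ⟨⟨fun b _ => ⟨_, SkewPowerSeries.isRightSeries_rightSum b⟩,
      SkewPowerSeries.leftSeries_eq_rightSeries hI⟩,
    SetLike.coe_injective ?_, ?_, SkewPowerSeries.coe_sumsOfProducts_C_univ hI,
    (SkewPowerSeries.coe_sumsOfProducts_univ_C hI).symm,
    SkewPowerSeries.seriesIdeal h hI, inferInstance, h.quotient hI,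
    SkewPowerSeries.quotientEquiv h hI, rfl, fun f n => rfl⟩
  · rw [SkewPowerSeries.coe_sumsOfProducts_C_polySubring hI,
      SkewPowerSeries.coe_sumsOfProducts_polySubring_C hI]
  · rw [SkewPowerSeries.coe_sumsOfProducts_C_polySubring hI]
    exact SkewPowerSeries.leftSeries_eq_closure hI
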